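/- Fix an integer $k\ge 1$. For $p\in[0,1]$ let $Y(n,p)$ be the random simplicial complex on the vertex set $[n]$ that contains every nonempty subset of $[n]$ with at most $k$ elements, contains no subset with more than $k+1$ elements, and contains each $(k+1)$-element subset ($k$-face) with probability $p$, independently of all the others. Let $HG(n,p)$ be the random hypergraph whose hypervertices are the $(k-1)$-faces ($k$-element subsets of $[n]$) and whose hyperedges are the $k$-faces $\sigma$ of $Y(n,p)$, where $\sigma$ is regarded as the set of the $(k-1)$-faces contained in it. A $(k-1)$-face is isolated if it is contained in no $k$-face of $Y(n,p)$. Two $(k-1)$-faces are in the same component if they are joined by a finite sequence of $(k-1)$-faces in which any two consecutive ones have a union that is a $k$-face of $Y(n,p)$, and $HG(n,p)$ is connected if every two $(k-1)$-faces are joined in this way. **Theorem 1.8.** (a) Let $c\in\mathbb R$ be constant and let $p=p_n\in[0,1]$ satisfy $p=\dfrac{k\log n+c}{n}$ for all sufficiently large $n$. Then, as $n\to\infty$: 1. with probability tending to $1$, $HG(n,p)$ consists of a giant component and isolated $(k-1)$-faces; precisely, for every $\varepsilon>0$, with probability tending to $1$ there is a component containing at least $(1-\varepsilon)\binom nk$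 of the $(k-1)$-faces such that every $(k-1)$-face outside it is isolated; 2. the number of isolated $(k-1)$-faces converges in distribution to a Poisson random variable with mean $e^{-c}/k!$; 3. $\mathbb P[HG(n,p)\text{ is connected}]\to \exp\!\left(-e^{-c}/k!\right)$. (b) Consequently $p=\dfrac{k\log n}{n}$ is a sharp threshold for connectedness of $HG(n,p)$: whenever $\omega=\omega_n\to\infty$ and $p=p_n\in[0,1]$, if $p\ge\dfrac{k\log n+\omega}{n}$ for all sufficiently large $n$ then $\mathbb P[HG(n,p)\text{ is connected}]\to1$, and if $p\le\dfrac{k\log n-\omega}{n}$ for all sufficiently large $n$ then $\mathbb P[HG(n,p)\text{ is connected}]\to0$. -/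

import Mathlib

open MeasureTheory ProbabilityTheory Filter Topology

namespace RandomComplex

variable {V : Type*} {n k : ℕ}

/-- The faces of `S` with exactly `m` vertices, i.e. the faces of dimension `m - 1`. -/
def facesOfCard (S : AbstractSimplicialComplex V) (m : ℕ) : Set (Finset V) :=
  {α | α ∈ S.faces ∧ α.card = m}

/-- The hypergraph induced by the `k`-faces of a complex `S`: its hypervertices are the
`(k-1)`-faces of `S`, and each `k`-face `σ` of `S` is a hyperedge, consisting of the `(k-1)`-faces
contained in `σ`. -/
def inducedHypergraph (S : AbstractSimplicialComplex V) (k : ℕ) : Hypergraph (Finset V) where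
  vertexSet := facesOfCard S k
  edgeSet := (fun σ => {α | α ∈ facesOfCard S k ∧ α ⊆ σ}) '' facesOfCard S (k + 1)
  subset_vertexSet_of_mem_edgeSet' := by
    rintro _ ⟨σ, _, rfl⟩ α hα
    exact hα.1

/-- Two distinct `(k-1)`-faces lie in a common hyperedge iff their union is a `k`-face. -/
theorem inducedHypergraph_adj_iff [DecidableEq V] (hk : 1 ≤ k) (S : AbstractSimplicialComplex V)
    {α β : Finset V} (hα : α.card = k) (hβ : β.card = k) (hne : α ≠ β) :
    (inducedHypergraph S k).Adj α β ↔ α ∪ β ∈ facesOfCard S (k + 1) := by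
  have hlt : k < (α ∪ β).card := by
    rcases Finset.subset_union_left.eq_or_ssubset (a := α) (b := α ∪ β) with h | h
    · have hsub : β ⊆ α := Finset.union_eq_left.1 h.symm
      exact absurd (Finset.eq_of_subset_of_card_le hsub (by omega)).symm hne
    · exact hα ▸ Finset.card_lt_card h
  constructor
  · rintro ⟨_, ⟨σ, hσ, rfl⟩, h1, h2⟩
    have hle : α ∪ β ⊆ σ := Finset.union_subset h1.2 h2.2
    have : α ∪ β = σ := Finset.eq_of_subset_of_card_le hle (by rw [hσ.2]; omega)
    rwa [this]
  · intro h
    have key : ∀ γ : Finset V, γ.card = k → γ ⊆ α ∪ β → γ ∈ S.faces := fun γ hγ hs =>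
      (S.isRelLowerSet_faces h.1).2 hs (Finset.card_pos.1 (by omega))
    exact ⟨_, ⟨_, h, rfl⟩,
      ⟨⟨key α hα Finset.subset_union_left, hα⟩, Finset.subset_union_left⟩,
      ⟨⟨key β hβ Finset.subset_union_right, hβ⟩, Finset.subset_union_right⟩⟩

/-- `x` and `y` are joined by a finite path in which consecutive hypervertices share a
hyperedge. -/
def Joined {W : Type*} (H : Hypergraph W) (x y : W) : Prop :=
  Relation.ReflTransGen H.Adj x y

/-- `H` is connected: every two hypervertices are joined by a path. -/
def IsConnected {W : Type*} (H : Hypergraph W) : Prop :=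
  ∀ x ∈ H.vertexSet, ∀ y ∈ H.vertexSet, Joined H x y

/-- `C` is a connected component of `H`. -/
def IsComponent {W : Type*} (H : Hypergraph W) (C : Set W) : Prop :=
  ∃ x ∈ H.vertexSet, C = {y | y ∈ H.vertexSet ∧ Joined H x y}

/-- The set of isolated hypervertices: those contained in no hyperedge. -/
def isolated {W : Type*} (H : Hypergraph W) : Set W :=
  {x | x ∈ H.vertexSet ∧ H.IsIsolated x}

/-- `H` consists of one component containing at least a proportion `1 - ε` of all hypervertices,
together with isolated hypervertices. -/
def IsGiantPlusIsolated {W : Type*} (H : Hypergraph W) (ε : ℝ) : Prop :=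
  ∃ C, IsComponent H C ∧ (1 - ε) * (H.vertexSet.ncard : ℝ) ≤ (C.ncard : ℝ) ∧
    H.vertexSet \ C ⊆ isolated H

/-- The simplicial complex on `n` vertices with complete `(k-1)`-skeleton whose `k`-faces are the
`(k+1)`-element sets belonging to `X`. -/
def complexOf (hk : 1 ≤ k) (X : Set (Finset (Fin n))) : AbstractSimplicialComplex (Fin n) where
  faces := {α | α.Nonempty ∧ (α.card ≤ k ∨ (α.card = k + 1 ∧ α ∈ X))}
  isRelLowerSet_faces := by
    rintro σ ⟨hne, hσ⟩
    refine ⟨hne, fun τ hτ hτne => ⟨hτne, ?_⟩⟩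
    have hle := Finset.card_le_card hτ
    rcases hσ with h | ⟨h, hX⟩
    · exact Or.inl (hle.trans h)
    · by_cases hc : τ.card ≤ k
      · exact Or.inl hc
      · have : τ = σ := Finset.eq_of_subset_of_card_le hτ (by omega)
        exact Or.inr (this ▸ ⟨h, hX⟩)
  singleton_mem v := ⟨Finset.singleton_nonempty v, Or.inl (by simpa using hk)⟩

/-- The law of the random set of `k`-faces of `Y(n,p)`: every `(k+1)`-element subset of the vertex
set is included with probability `p`, independently of all others. -/
noncomputable abbrev faceLaw (n k : ℕ) (p : unitInterval) : Measure (Set (Finset (Fin n))) :=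
  setBernoulli {σ | σ.card = k + 1} p

/-- The hypergraph `HG(n,p)` as a function of the random set `X` of `k`-faces; here `X` has law
`faceLaw n k p`, so that `complexOf hk X` is the random complex `Y(n,p)`. -/
def HG (hk : 1 ≤ k) (X : Set (Finset (Fin n))) : Hypergraph (Finset (Fin n)) :=
  inducedHypergraph (complexOf hk X) k

end RandomComplex

/-! A (k-1)-face is isolated exactly when its n - k cofaces are all absent, so the expected number
of isolated faces is C(n,k)(1-p)^(n-k), which tends to λ = e^(-c)/k! in the window. Two distinct
(k-1)-faces have at most one common coface, so r given faces have between r(n-k) - r² and r(n-k)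
cofaces in total. As p → 0, the r² overlap is negligible, the r-th binomial moment tends to λ^r/r!
(`tendsto_binomialMoment`), and Bonferroni's inequalities turn this into Poisson point
probabilities.

It remains to see that isolated faces are the only obstruction to connectedness. The link of a
(k-2)-face τ is a random graph on n - k + 1 vertices. With high probability no link has a set of at
most half of its vertices that spans an edge and has no edge leaving it
(`exists_faceLaw_real_hasSmallCluster_le`). Then every component of `HG` containing a non-isolated
face through τ covers more than half of that link, so all such faces are joined to each other.
Arbitrary non-isolated faces are then joined by exchanging vertices through a fresh vertex that lies
in no isolated face (`joined_of_not_hasSmallCluster`); such a vertex exists because Markov's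
inequality keeps isolated faces few.

Hence connectedness and absence of isolated faces differ by an event of vanishing probability. Above
the window the first moment excludes isolated faces; below it the second moment forces one to exist.
-/

namespace RandomComplex

variable {n k : ℕ}

/-! ### Deterministic structure: links, isolated faces and components. -/

section Structure

theorem vertexSet_HG (hk : 1 ≤ k) (X : Set (Finset (Fin n))) :
    (HG hk X).vertexSet = {α | α.card = k} := by
  ext α
  constructor
  · exact fun h => h.2
  · intro h
    exact ⟨⟨Finset.card_pos.1 (by rw [show α.card = k from h]; omega), Or.inl (le_of_eq h)⟩, h⟩

theorem mem_vertexSet_HG {hk : 1 ≤ k} {X : Set (Finset (Fin n))} {α : Finset (Fin n)} :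
    α ∈ (HG hk X).vertexSet ↔ α.card = k := by
  rw [vertexSet_HG]; rfl

theorem ncard_vertexSet_HG (hk : 1 ≤ k) (X : Set (Finset (Fin n))) :
    (HG hk X).vertexSet.ncard = n.choose k := by
  rw [vertexSet_HG]
  have : {α : Finset (Fin n) | α.card = k} =
      ((Finset.powersetCard k Finset.univ : Finset (Finset (Fin n))) : Set (Finset (Fin n))) := by
    ext; simp
  rw [this, Set.ncard_coe_finset]; simp

theorem mem_edgeSet_HG {hk : 1 ≤ k} {X : Set (Finset (Fin n))} {e : Set (Finset (Fin n))} :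
    e ∈ (HG hk X).edgeSet ↔ ∃ σ ∈ X, σ.card = k + 1 ∧ e = {α | α.card = k ∧ α ⊆ σ} := by
  have key : ∀ σ : Finset (Fin n), {α | α ∈ facesOfCard (complexOf hk X) k ∧ α ⊆ σ} =
      {α | α.card = k ∧ α ⊆ σ} := by
    intro σ
    ext α
    have := @mem_vertexSet_HG n k hk X α
    exact and_congr_left fun _ => this
  constructor
  · rintro ⟨σ, ⟨⟨_, h⟩, hσ⟩, rfl⟩
    exact ⟨σ, by rcases h with h | h; · omega
                 exact h.2, hσ, key σ⟩
  · rintro ⟨σ, hX, hσ, rfl⟩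
    exact ⟨σ, ⟨⟨Finset.card_pos.1 (by omega), Or.inr ⟨hσ, hX⟩⟩, hσ⟩, key σ⟩

theorem adj_HG {hk : 1 ≤ k} {X : Set (Finset (Fin n))} {α β σ : Finset (Fin n)} (hσ : σ ∈ X)
    (hc : σ.card = k + 1) (hα : α.card = k) (hβ : β.card = k) (h₁ : α ⊆ σ) (h₂ : β ⊆ σ) :
    (HG hk X).Adj α β :=
  ⟨_, mem_edgeSet_HG.2 ⟨σ, hσ, hc, rfl⟩, ⟨hα, h₁⟩, ⟨hβ, h₂⟩⟩

theorem Joined.symm {W : Type*} {H : Hypergraph W} {x y : W} (h : Joined H x y) : Joined H y x := by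
  unfold Joined at h ⊢
  induction h with
  | refl => exact .refl
  | tail _ h ih => exact ih.head h.symm

theorem Joined.trans {W : Type*} {H : Hypergraph W} {x y z : W} (h : Joined H x y)
    (h' : Joined H y z) : Joined H x z :=
  Relation.ReflTransGen.trans h h'

open Classical in
/-- The isolated `(k-1)`-faces, as a finite set. -/
noncomputable def isolatedFaces (k : ℕ) (X : Set (Finset (Fin n))) : Finset (Finset (Fin n)) :=
  (Finset.powersetCard k Finset.univ).filter fun α => ∀ σ, σ.card = k + 1 → α ⊆ σ → σ ∉ X

theorem mem_isolatedFaces {X : Set (Finset (Fin n))} {α : Finset (Fin n)} :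
    α ∈ isolatedFaces k X ↔ α.card = k ∧ ∀ σ, σ.card = k + 1 → α ⊆ σ → σ ∉ X := by
  simp [isolatedFaces]

theorem isolated_HG (hk : 1 ≤ k) (X : Set (Finset (Fin n))) :
    isolated (HG hk X) = ↑(isolatedFaces k X) := by
  ext α
  simp only [isolated, Set.mem_ofPred_eq, mem_vertexSet_HG, Finset.mem_coe, mem_isolatedFaces,
    Hypergraph.IsIsolated]
  refine and_congr_right fun hα => ⟨fun h σ hσ hs hX => ?_, fun h e he hα' => ?_⟩
  · exact h _ (mem_edgeSet_HG.2 ⟨σ, hX, hσ, rfl⟩) ⟨hα, hs⟩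
  · obtain ⟨σ, hX, hσ, rfl⟩ := mem_edgeSet_HG.1 he
    exact h σ hσ hα'.2 hX

theorem eq_of_joined_of_mem_isolatedFaces {hk : 1 ≤ k} {X : Set (Finset (Fin n))}
    {α β : Finset (Fin n)} (hα : α ∈ isolatedFaces k X) (h : Joined (HG hk X) α β) : α = β := by
  rcases Relation.ReflTransGen.cases_head h with h | ⟨γ, ⟨e, he, h₁, -⟩, -⟩
  · exact h
  · rw [← Finset.mem_coe, ← isolated_HG hk] at hα
    exact absurd h₁ (hα.2 e he)

/-- Some link of a `(k-2)`-face `τ`, seen as a graph, has a set `B` of at most half of the vertices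
that spans an edge but is joined to no vertex outside of it. -/
def HasSmallCluster (k : ℕ) (X : Set (Finset (Fin n))) : Prop :=
  ∃ τ B : Finset (Fin n), τ.card + 1 = k ∧ Disjoint τ B ∧ 2 * B.card ≤ n - τ.card ∧
    (∃ u ∈ B, ∃ w ∈ B, u ≠ w ∧ insert u (insert w τ) ∈ X) ∧
    ∀ v ∈ B, ∀ z, z ∉ B → z ∉ τ → insert v (insert z τ) ∉ X

/-- `B` is the trace on the link of τ of a whole component of `HG`, not merely of a component of the
link. Link edges are adjacencies in `HG`, so no link edge leaves `B`; non-isolation puts an edge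
inside it. Only its size can prevent `B` from being a small cluster. -/
theorem lt_card_of_not_hasSmallCluster {hk : 1 ≤ k} {X : Set (Finset (Fin n))}
    (hX : ¬ HasSmallCluster k X) {τ : Finset (Fin n)} (hτ : τ.card + 1 = k) {v : Fin n}
    (hv : v ∉ τ) (hiso : insert v τ ∉ isolatedFaces k X) {B : Finset (Fin n)}
    (hB : ∀ u, u ∈ B ↔ u ∉ τ ∧ Joined (HG hk X) (insert v τ) (insert u τ)) :
    n - τ.card < 2 * B.card := by
  by_contra! hle
  have hcard : ∀ u, u ∉ τ → (insert u τ).card = k := fun u hu => by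
    rw [Finset.card_insert_of_notMem hu, hτ]
  have hstep : ∀ u w, u ∉ τ → w ∉ τ → u ≠ w → insert u (insert w τ) ∈ X →
      (HG hk X).Adj (insert u τ) (insert w τ) := by
    intro u w hu hw hne hmem
    refine adj_HG hmem ?_ (hcard u hu) (hcard w hw) ?_ ?_
    · rw [Finset.card_insert_of_notMem (by simp [hne, hu]), hcard w hw]
    · exact Finset.insert_subset_insert _ (Finset.subset_insert _ _)
    · exact Finset.subset_insert _ _
  refine hX ⟨τ, B, hτ, ?_, hle, ?_, ?_⟩
  · exact Finset.disjoint_right.2 fun u hu => ((hB u).1 hu).1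
  · rw [mem_isolatedFaces] at hiso
    push Not at hiso
    obtain ⟨σ, hσ, hs, hσX⟩ := hiso (hcard v hv)
    obtain ⟨w, hw⟩ : ∃ w, σ \ insert v τ = {w} := by
      rw [← Finset.card_eq_one, Finset.card_sdiff_of_subset hs, hσ, hcard v hv]; omega
    have hwm : w ∈ σ ∧ w ∉ insert v τ := by
      rw [← Finset.mem_sdiff, hw]; simp
    have hσe : insert v (insert w τ) = σ := by
      rw [Finset.insert_comm, ← Finset.singleton_union, ← hw]
      exact Finset.sdiff_union_of_subset hs
    have hne : v ≠ w := fun h => hwm.2 (by simp [h])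
    have hwτ : w ∉ τ := fun h => hwm.2 (by simp [h])
    refine ⟨v, (hB v).2 ⟨hv, Relation.ReflTransGen.refl⟩, w, (hB w).2 ⟨hwτ, ?_⟩, hne, ?_⟩
    · exact Relation.ReflTransGen.single (hstep v w hv hwτ hne (hσe ▸ hσX))
    · rwa [hσe]
  · intro u hu z hzB hz hmem
    have hu' := (hB u).1 hu
    refine hzB ((hB z).2 ⟨hz, hu'.2.tail (hstep u z hu'.1 hz ?_ hmem)⟩)
    rintro rfl
    exact hzB hu

/-- The traces of the two components on the link each exceed half of its vertices, so they
intersect. -/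
theorem joined_of_mem_link {hk : 1 ≤ k} {X : Set (Finset (Fin n))}
    (hX : ¬ HasSmallCluster k X) {τ : Finset (Fin n)} (hτ : τ.card + 1 = k) {v w : Fin n}
    (hv : v ∉ τ) (hw : w ∉ τ) (hiv : insert v τ ∉ isolatedFaces k X)
    (hiw : insert w τ ∉ isolatedFaces k X) :
    Joined (HG hk X) (insert v τ) (insert w τ) := by
  classical
  set B : Fin n → Finset (Fin n) := fun v => Finset.univ.filter fun u =>
    u ∉ τ ∧ Joined (HG hk X) (insert v τ) (insert u τ) with hBdef
  have hB : ∀ v u, u ∈ B v ↔ u ∉ τ ∧ Joined (HG hk X) (insert v τ) (insert u τ) := by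
    simp [hBdef]
  have h₁ := lt_card_of_not_hasSmallCluster hX hτ hv hiv (hB v)
  have h₂ := lt_card_of_not_hasSmallCluster hX hτ hw hiw (hB w)
  have hsub : B v ∪ B w ⊆ τᶜ := by
    intro u hu
    rcases Finset.mem_union.1 hu with h | h
    · exact Finset.mem_compl.2 ((hB _ _).1 h).1
    · exact Finset.mem_compl.2 ((hB _ _).1 h).1
  have h₃ := Finset.card_le_card hsub
  rw [Finset.card_compl, Fintype.card_fin] at h₃
  have h₄ := Finset.card_union_add_card_inter (B v) (B w)
  obtain ⟨u, hu⟩ : (B v ∩ B w).Nonempty := Finset.card_pos.1 (by omega)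
  rw [Finset.mem_inter, hB, hB] at hu
  exact hu.1.2.trans hu.2.2.symm

theorem joined_insert_erase {hk : 1 ≤ k} {X : Set (Finset (Fin n))}
    (hX : ¬ HasSmallCluster k X) {α : Finset (Fin n)} {a v : Fin n} (hα : α.card = k) (ha : a ∈ α)
    (hv : v ∉ α) (h₁ : α ∉ isolatedFaces k X) (h₂ : insert v (α.erase a) ∉ isolatedFaces k X) :
    Joined (HG hk X) α (insert v (α.erase a)) := by
  have hτ : (α.erase a).card + 1 = k := by rw [Finset.card_erase_add_one ha, hα]
  have := joined_of_mem_link (hk := hk) hX hτ (Finset.notMem_erase a α)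
    (fun h => hv (Finset.mem_of_mem_erase h)) (by rwa [Finset.insert_erase ha]) h₂
  rwa [Finset.insert_erase ha] at this

/-- If no link has a small cluster and there are few isolated faces, then all faces that are not
isolated lie in one component. -/
theorem joined_of_not_hasSmallCluster {hk : 1 ≤ k} {X : Set (Finset (Fin n))}
    (hX : ¬ HasSmallCluster k X) (hfew : k * (isolatedFaces k X).card + 2 * k < n)
    {α β : Finset (Fin n)} (hα : α.card = k) (hβ : β.card = k) (hiα : α ∉ isolatedFaces k X)
    (hiβ : β ∉ isolatedFaces k X) : Joined (HG hk X) α β := by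
  obtain ⟨d, hd⟩ : ∃ d, (α \ β).card = d := ⟨_, rfl⟩
  induction d generalizing α β with
  | zero =>
    rw [Finset.card_eq_zero, Finset.sdiff_eq_empty_iff_subset] at hd
    rw [Finset.eq_of_subset_of_card_le hd (by omega)]
    exact Relation.ReflTransGen.refl
  | succ d ih =>
    -- The fresh vertex: α ∪ β has at most 2k vertices and each isolated face has k, which is what
    -- `hfew` counts. Every face through `v` is non-isolated, so exchanging `a` and `b` for `v` is
    -- allowed and removes `a` from the difference α \ β.
    obtain ⟨v, hv⟩ : ∃ v, v ∉ (α ∪ β) ∪ (isolatedFaces k X).biUnion id := by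
      by_contra! h
      have h₁ := Finset.card_le_card (fun v _ => h v : Finset.univ ⊆ _)
      have h₂ := Finset.card_union_le (α ∪ β) ((isolatedFaces k X).biUnion id)
      have h₃ := Finset.card_union_le α β
      have h₄ := Finset.card_biUnion_le_card_mul (isolatedFaces k X) id k
        (fun γ hγ => (mem_isolatedFaces.1 hγ).1.le)
      rw [Finset.card_univ, Fintype.card_fin] at h₁
      rw [mul_comm] at h₄
      omega
    simp only [Finset.mem_union, Finset.mem_biUnion, not_or, not_exists, not_and, id] at hv
    obtain ⟨⟨hvα, hvβ⟩, hvi⟩ := hv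
    obtain ⟨a, ha⟩ : (α \ β).Nonempty := Finset.card_pos.1 (by omega)
    obtain ⟨b, hb⟩ : (β \ α).Nonempty := by
      have := Finset.card_sdiff_add_card_inter α β
      have := Finset.card_sdiff_add_card_inter β α
      rw [Finset.inter_comm] at this
      exact Finset.card_pos.1 (by omega)
    rw [Finset.mem_sdiff] at ha hb
    have hgood : ∀ γ : Finset (Fin n), insert v γ ∉ isolatedFaces k X := fun γ h =>
      hvi _ h (Finset.mem_insert_self _ _)
    refine (joined_insert_erase hX hα ha.1 hvα hiα (hgood _)).trans
      (Joined.trans (ih ?_ ?_ (hgood _) (hgood _) ?_)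
        (joined_insert_erase hX hβ hb.1 hvβ hiβ (hgood _)).symm)
    · rw [Finset.card_insert_of_notMem (fun h => hvα (Finset.mem_of_mem_erase h)),
        Finset.card_erase_add_one ha.1, hα]
    · rw [Finset.card_insert_of_notMem (fun h => hvβ (Finset.mem_of_mem_erase h)),
        Finset.card_erase_add_one hb.1, hβ]
    · have : insert v (α.erase a) \ insert v (β.erase b) = (α \ β).erase a := by
        ext x; simp only [Finset.mem_sdiff, Finset.mem_insert, Finset.mem_erase]; grind
      rw [this, Finset.card_erase_of_mem (Finset.mem_sdiff.2 ha), hd]; rfl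

theorem isConnected_of_isolatedFaces_eq_empty {hk : 1 ≤ k} {X : Set (Finset (Fin n))}
    (hX : ¬ HasSmallCluster k X) (hn : 2 * k < n) (h : isolatedFaces k X = ∅) :
    IsConnected (HG hk X) := by
  intro α hα β hβ
  exact joined_of_not_hasSmallCluster hX (by simpa [h] using hn) (mem_vertexSet_HG.1 hα)
    (mem_vertexSet_HG.1 hβ) (by simp [h]) (by simp [h])

/-- An isolated face is joined only to itself, and k < n provides a second face. For n = k the
single face is isolated while `HG` is connected. -/
theorem isolatedFaces_eq_empty_of_isConnected {hk : 1 ≤ k} {X : Set (Finset (Fin n))}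
    (hn : k < n) (h : IsConnected (HG hk X)) : isolatedFaces k X = ∅ := by
  by_contra hne
  obtain ⟨α, hα⟩ := Finset.nonempty_iff_ne_empty.2 hne
  have hαk := (mem_isolatedFaces.1 hα).1
  obtain ⟨a, ha⟩ : α.Nonempty := Finset.card_pos.1 (by omega)
  obtain ⟨v, hv⟩ : ∃ v, v ∉ α := by
    by_contra! h'
    have := Finset.card_le_card (fun v _ => h' v : Finset.univ ⊆ α)
    rw [Finset.card_univ, Fintype.card_fin] at this
    omega
  have hc : (insert v (α.erase a)).card = k := by
    rw [Finset.card_insert_of_notMem (fun h => hv (Finset.mem_of_mem_erase h)),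
        Finset.card_erase_add_one ha, hαk]
  have := eq_of_joined_of_mem_isolatedFaces hα
    (h α (mem_vertexSet_HG.2 hαk) _ (mem_vertexSet_HG.2 hc))
  exact hv (this ▸ Finset.mem_insert_self _ _)

theorem isGiantPlusIsolated_of_not_hasSmallCluster {hk : 1 ≤ k} {X : Set (Finset (Fin n))}
    (hX : ¬ HasSmallCluster k X) (hfew : k * (isolatedFaces k X).card + 2 * k < n) {ε : ℝ}
    (hε : ((isolatedFaces k X).card : ℝ) ≤ ε * n.choose k) :
    IsGiantPlusIsolated (HG hk X) ε := by
  obtain ⟨v, hv⟩ : ∃ v, v ∉ (isolatedFaces k X).biUnion id := by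
    by_contra! h
    have h₁ := Finset.card_le_card (fun v _ => h v : Finset.univ ⊆ _)
    have h₄ := Finset.card_biUnion_le_card_mul (isolatedFaces k X) id k
      (fun γ hγ => (mem_isolatedFaces.1 hγ).1.le)
    rw [Finset.card_univ, Fintype.card_fin] at h₁
    rw [mul_comm] at h₄
    omega
  obtain ⟨α, hvα, hα⟩ : ∃ α : Finset (Fin n), {v} ⊆ α ∧ α.card = k := by
    obtain ⟨α, h₁, -, h₂⟩ := Finset.exists_subsuperset_card_eq (Finset.subset_univ {v})
      (n := k) (by simpa using hk) (by simp; omega)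
    exact ⟨α, h₁, h₂⟩
  have hiα : α ∉ isolatedFaces k X := fun h =>
    hv (Finset.mem_biUnion.2 ⟨α, h, Finset.singleton_subset_iff.1 hvα⟩)
  set C : Set (Finset (Fin n)) := {y | y ∈ (HG hk X).vertexSet ∧ Joined (HG hk X) α y} with hC
  have hsub : (HG hk X).vertexSet \ C ⊆ isolated (HG hk X) := by
    rintro β ⟨hβ, hβC⟩
    rw [isolated_HG]
    by_contra hiβ
    exact hβC ⟨hβ, joined_of_not_hasSmallCluster hX hfew hα (mem_vertexSet_HG.1 hβ) hiα hiβ⟩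
  refine ⟨C, ⟨α, mem_vertexSet_HG.2 hα, rfl⟩, ?_, hsub⟩
  have h₁ := Set.ncard_le_ncard hsub (Set.toFinite _)
  have h₂ : C ⊆ (HG hk X).vertexSet := fun _ h => h.1
  have h₃ := Set.ncard_sdiff_add_ncard_of_subset h₂ (Set.toFinite _)
  rw [isolated_HG, Set.ncard_coe_finset] at h₁
  rw [ncard_vertexSet_HG] at h₃ ⊢
  have h₁' : (((HG hk X).vertexSet \ C).ncard : ℝ) ≤ (isolatedFaces k X).card := by
    exact_mod_cast h₁
  have h₃' : (((HG hk X).vertexSet \ C).ncard : ℝ) + C.ncard = n.choose k := by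
    exact_mod_cast h₃
  linarith

end Structure

/-! ### Independence, cofaces and binomial moments of the number of isolated faces. -/

section Probability

/-- The probability that all sets of `S` and none of `T` are faces. -/
theorem faceLaw_real_subset_disjoint (p : unitInterval) {S T : Finset (Finset (Fin n))}
    (hS : ∀ σ ∈ S, σ.card = k + 1) (hT : ∀ σ ∈ T, σ.card = k + 1) (hST : Disjoint S T) :
    (faceLaw n k p).real {X | (∀ σ ∈ S, σ ∈ X) ∧ ∀ σ ∈ T, σ ∉ X} =
      (p : ℝ) ^ S.card * (1 - p : ℝ) ^ T.card := by
  classical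
  -- In the product space defining `setBernoulli` the event is a box: coordinates in `S` are true,
  -- those in `T` are false, the others are free.
  have h₁ : (fun (q : Finset (Fin n) → Prop) => {i | q i}) ⁻¹'
      {X | (∀ σ ∈ S, σ ∈ X) ∧ ∀ σ ∈ T, σ ∉ X} =
      Set.pi ↑(S ∪ T) (fun i => if i ∈ S then {True} else {False}) := by
    ext q
    simp only [Set.mem_preimage, Set.mem_ofPred_eq, Set.mem_pi, Finset.mem_coe, Finset.mem_union]
    constructor
    · rintro ⟨h, h'⟩ σ hσ
      by_cases hs : σ ∈ S
      · simp [hs, h σ hs]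
      · simp [hs, h' σ (hσ.resolve_left hs)]
    · intro h
      refine ⟨fun σ hσ => ?_, fun σ hσ => ?_⟩
      · simpa [hσ] using h σ (Or.inl hσ)
      · have hs : σ ∉ S := Finset.disjoint_right.1 hST hσ
        simpa [hs] using h σ (Or.inr hσ)
  rw [measureReal_def, setBernoulli_apply', h₁, Measure.infinitePi_pi _ (fun _ _ => .of_discrete),
    Finset.prod_union hST, ENNReal.toReal_mul, ENNReal.toReal_prod, ENNReal.toReal_prod]
  congr 1
  · rw [← Finset.prod_const]
    refine Finset.prod_congr rfl fun σ hσ => ?_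
    simp [hσ, hS σ hσ]
  · rw [← Finset.prod_const]
    refine Finset.prod_congr rfl fun σ hσ => ?_
    have hs : σ ∉ S := Finset.disjoint_right.1 hST hσ
    simp [hs, hT σ hσ]

/-- The `(k+1)`-element sets that contain some member of `A`. -/
def cofaces (k : ℕ) (A : Finset (Finset (Fin n))) : Finset (Finset (Fin n)) :=
  (Finset.powersetCard (k + 1) Finset.univ).filter fun σ => ∃ α ∈ A, α ⊆ σ

theorem mem_cofaces {A : Finset (Finset (Fin n))} {σ : Finset (Fin n)} :
    σ ∈ cofaces k A ↔ σ.card = k + 1 ∧ ∃ α ∈ A, α ⊆ σ := by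
  simp [cofaces]

theorem card_cofaces_singleton {α : Finset (Fin n)} (hα : α.card = k) :
    (cofaces k {α}).card = n - k := by
  have : cofaces k {α} = αᶜ.image (fun v => insert v α) := by
    ext σ
    simp only [mem_cofaces, Finset.mem_singleton, exists_eq_left, Finset.mem_image,
      Finset.mem_compl]
    constructor
    · rintro ⟨hσ, hs⟩
      obtain ⟨w, hw⟩ : ∃ w, σ \ α = {w} := by
        rw [← Finset.card_eq_one, Finset.card_sdiff_of_subset hs]; omega
      refine ⟨w, (Finset.mem_sdiff.1 (hw ▸ Finset.mem_singleton_self w)).2, ?_⟩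
      rw [← Finset.singleton_union, ← hw, Finset.sdiff_union_of_subset hs]
    · rintro ⟨v, hv, rfl⟩
      exact ⟨by rw [Finset.card_insert_of_notMem hv, hα], Finset.subset_insert _ _⟩
  rw [this, Finset.card_image_of_injOn, Finset.card_compl, Fintype.card_fin, hα]
  intro v hv w hw h
  have hv' : v ∉ α := by simpa using hv
  have : v ∈ insert w α := (show insert v α = insert w α from h) ▸ Finset.mem_insert_self v α
  exact (Finset.mem_insert.1 this).resolve_right hv'

theorem cofaces_insert (α : Finset (Fin n)) (A : Finset (Finset (Fin n))) :
    cofaces k (insert α A) = cofaces k {α} ∪ cofaces k A := by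
  ext σ
  simp only [mem_cofaces, Finset.mem_union, Finset.mem_insert, Finset.mem_singleton]
  grind

theorem card_cofaces_le {A : Finset (Finset (Fin n))} (hA : ∀ α ∈ A, α.card = k) :
    (cofaces k A).card ≤ A.card * (n - k) := by
  classical
  induction A using Finset.induction_on with
  | empty => simp [cofaces]
  | insert α A hα ih =>
    rw [cofaces_insert, Finset.card_insert_of_notMem hα]
    have h₁ := Finset.card_union_le (cofaces k {α}) (cofaces k A)
    rw [card_cofaces_singleton (hA α (Finset.mem_insert_self _ _))] at h₁
    have := ih fun β hβ => hA β (Finset.mem_insert_of_mem hβ)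
    linarith

/-- A common coface of α and β ≠ α must be α ∪ β, so each member of `A` accounts for at most one. -/
theorem card_inter_cofaces_le {A : Finset (Finset (Fin n))} {α : Finset (Fin n)}
    (hα : α.card = k) (hαA : α ∉ A) (hA : ∀ α ∈ A, α.card = k) :
    (cofaces k {α} ∩ cofaces k A).card ≤ A.card := by
  refine le_trans (Finset.card_le_card ?_) (Finset.card_image_le (s := A) (f := fun β => α ∪ β))
  intro σ hσ
  simp only [Finset.mem_inter, mem_cofaces, Finset.mem_singleton, exists_eq_left] at hσ
  obtain ⟨⟨hσ, h₁⟩, -, β, hβ, h₂⟩ := hσ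
  refine Finset.mem_image.2 ⟨β, hβ, Finset.eq_of_subset_of_card_le (Finset.union_subset h₁ h₂) ?_⟩
  have hne : α ≠ α ∪ β := by
    intro h
    have : β ⊆ α := by rw [h]; exact Finset.subset_union_right
    exact hαA (Finset.eq_of_subset_of_card_le this (by rw [hα, hA β hβ]) ▸ hβ)
  have := Finset.card_lt_card (Finset.ssubset_iff_subset_ne.2 ⟨Finset.subset_union_left, hne⟩)
  omega

theorem le_card_cofaces {A : Finset (Finset (Fin n))} (hA : ∀ α ∈ A, α.card = k) :
    A.card * (n - k) ≤ (cofaces k A).card + A.card ^ 2 := by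
  classical
  induction A using Finset.induction_on with
  | empty => simp
  | insert α A hα ih =>
    have hαk := hA α (Finset.mem_insert_self _ _)
    have hA' : ∀ β ∈ A, β.card = k := fun β hβ => hA β (Finset.mem_insert_of_mem hβ)
    rw [cofaces_insert, Finset.card_insert_of_notMem hα]
    have h₁ := Finset.card_union_add_card_inter (cofaces k {α}) (cofaces k A)
    have h₂ := card_inter_cofaces_le hαk hα hA'
    rw [card_cofaces_singleton hαk] at h₁
    have := ih hA'
    nlinarith

theorem subset_isolatedFaces_iff {A : Finset (Finset (Fin n))} (hA : ∀ α ∈ A, α.card = k)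
    {X : Set (Finset (Fin n))} : A ⊆ isolatedFaces k X ↔ ∀ σ ∈ cofaces k A, σ ∉ X := by
  constructor
  · intro h σ hσ
    obtain ⟨hσ, α, hα, hs⟩ := mem_cofaces.1 hσ
    exact (mem_isolatedFaces.1 (h hα)).2 σ hσ hs
  · intro h α hα
    exact mem_isolatedFaces.2 ⟨hA α hα, fun σ hσ hs => h σ (mem_cofaces.2 ⟨hσ, α, hα, hs⟩)⟩

theorem faceLaw_real_subset_isolatedFaces (p : unitInterval) {A : Finset (Finset (Fin n))}
    (hA : ∀ α ∈ A, α.card = k) :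
    (faceLaw n k p).real {X | A ⊆ isolatedFaces k X} = (1 - p : ℝ) ^ (cofaces k A).card := by
  have := faceLaw_real_subset_disjoint (k := k) p (S := ∅) (T := cofaces k A) (by simp)
    (fun σ hσ => (mem_cofaces.1 hσ).1) (Finset.disjoint_empty_left _)
  simpa [subset_isolatedFaces_iff hA] using this

/-- The `r`-th binomial moment of the number of isolated faces. -/
noncomputable def binomialMoment (n k : ℕ) (p : unitInterval) (r : ℕ) : ℝ :=
  ∫ X, ((isolatedFaces k X).card.choose r : ℝ) ∂(faceLaw n k p)

theorem integrable_faceLaw (p : unitInterval) (f : Set (Finset (Fin n)) → ℝ) :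
    Integrable f (faceLaw n k p) :=
  Integrable.of_finite

theorem binomialMoment_eq (p : unitInterval) (r : ℕ) :
    binomialMoment n k p r = ∑ A ∈ (Finset.powersetCard k (Finset.univ : Finset (Fin n))).powersetCard r,
      (1 - p : ℝ) ^ (cofaces k A).card := by
  classical
  have h₁ : ∀ X : Set (Finset (Fin n)), ((isolatedFaces k X).card.choose r : ℝ) =
      ∑ A ∈ (Finset.powersetCard k (Finset.univ : Finset (Fin n))).powersetCard r,
        Set.indicator {X | A ⊆ isolatedFaces k X} (fun _ => (1 : ℝ)) X := by
    intro X
    simp only [Set.indicator_apply, Set.mem_ofPred_eq, Finset.sum_boole]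
    rw [← Finset.card_powersetCard]
    congr 2
    ext A
    simp only [Finset.mem_powersetCard, Finset.mem_filter]
    constructor
    · rintro ⟨h, h'⟩
      exact ⟨⟨fun α hα => Finset.mem_powersetCard.2
        ⟨Finset.subset_univ _, (mem_isolatedFaces.1 (h hα)).1⟩, h'⟩, h⟩
    · rintro ⟨⟨-, h⟩, h'⟩
      exact ⟨h', h⟩
  unfold binomialMoment
  simp_rw [h₁]
  rw [integral_finsetSum _ fun _ _ => integrable_faceLaw p _]
  refine Finset.sum_congr rfl fun A hA => ?_
  rw [← faceLaw_real_subset_isolatedFaces p fun α hα =>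
    (Finset.mem_powersetCard.1 ((Finset.mem_powersetCard.1 hA).1 hα)).2]
  exact integral_indicator_one .of_discrete

theorem choose_mul_pow_le_binomialMoment (p : unitInterval) (r : ℕ) :
    ((n.choose k).choose r : ℝ) * ((1 - p : ℝ) ^ (n - k)) ^ r ≤ binomialMoment n k p r := by
  rw [binomialMoment_eq, ← pow_mul]
  have h := Finset.card_nsmul_le_sum
    ((Finset.powersetCard k (Finset.univ : Finset (Fin n))).powersetCard r)
    (fun A => (1 - p : ℝ) ^ (cofaces k A).card) ((1 - p : ℝ) ^ ((n - k) * r)) ?_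
  · simpa using h
  · intro A hA
    rw [Finset.mem_powersetCard] at hA
    refine pow_le_pow_of_le_one (by linarith [p.2.2]) (by linarith [p.2.1]) ?_
    rw [mul_comm, ← hA.2]
    exact card_cofaces_le fun α hα => (Finset.mem_powersetCard.1 (hA.1 hα)).2

theorem binomialMoment_mul_pow_le (p : unitInterval) (r : ℕ) :
    binomialMoment n k p r * (1 - p : ℝ) ^ (r ^ 2) ≤
      ((n.choose k).choose r : ℝ) * ((1 - p : ℝ) ^ (n - k)) ^ r := by
  rw [binomialMoment_eq, ← pow_mul, Finset.sum_mul]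
  have h := Finset.sum_le_card_nsmul
    ((Finset.powersetCard k (Finset.univ : Finset (Fin n))).powersetCard r)
    (fun A => (1 - p : ℝ) ^ (cofaces k A).card * (1 - p : ℝ) ^ (r ^ 2))
    ((1 - p : ℝ) ^ ((n - k) * r)) ?_
  · simpa using h
  · intro A hA
    rw [Finset.mem_powersetCard] at hA
    rw [← pow_add]
    refine pow_le_pow_of_le_one (by linarith [p.2.2]) (by linarith [p.2.1]) ?_
    rw [mul_comm, ← hA.2]
    exact le_card_cofaces fun α hα => (Finset.mem_powersetCard.1 (hA.1 hα)).2

theorem binomialMoment_one (p : unitInterval) :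
    binomialMoment n k p 1 = (n.choose k : ℝ) * (1 - p : ℝ) ^ (n - k) := by
  rw [binomialMoment_eq, Finset.powersetCard_one, Finset.sum_map]
  rw [Finset.sum_congr rfl (g := fun _ => (1 - p : ℝ) ^ (n - k))]
  · simp
  · intro α hα
    simp only [Function.Embedding.coeFn_mk]
    rw [card_cofaces_singleton (Finset.mem_powersetCard.1 hα).2]

theorem faceLaw_real_mono (p : unitInterval) {s t : Set (Set (Finset (Fin n)))} (h : s ⊆ t) :
    (faceLaw n k p).real s ≤ (faceLaw n k p).real t :=
  measureReal_mono h

/-- Markov's inequality for the number of isolated faces. -/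
theorem mul_faceLaw_real_le_card_le (p : unitInterval) (a : ℝ) :
    a * (faceLaw n k p).real {X | a ≤ (isolatedFaces k X).card} ≤ binomialMoment n k p 1 := by
  have := mul_meas_ge_le_integral_of_nonneg (μ := faceLaw n k p)
    (f := fun X => ((isolatedFaces k X).card : ℝ)) (.of_forall fun X => by positivity)
    (integrable_faceLaw p _) a
  simpa [binomialMoment] using this

/-- The second moment bound for the probability that there is no isolated face. -/
theorem faceLaw_real_eq_empty_mul_le (p : unitInterval) :
    (faceLaw n k p).real {X | isolatedFaces k X = ∅} * binomialMoment n k p 1 ^ 2 ≤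
      2 * binomialMoment n k p 2 + binomialMoment n k p 1 - binomialMoment n k p 1 ^ 2 := by
  set M := binomialMoment n k p 1 with hM
  have h₁ : ∫ X, ((isolatedFaces k X).card.choose 1 : ℝ) ∂(faceLaw n k p) = M := rfl
  -- With W the number of isolated faces, W² = 2·C(W,2) + W, so the integrand is (W - M)². It equals
  -- M² where W = 0, which is Chebyshev's argument.
  have h₂ : ∫ X, (2 * ((isolatedFaces k X).card.choose 2 : ℝ) +
      (1 - 2 * M) * ((isolatedFaces k X).card.choose 1 : ℝ) + M ^ 2) ∂(faceLaw n k p) =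
      2 * binomialMoment n k p 2 + (1 - 2 * M) * M + M ^ 2 := by
    rw [integral_add (integrable_faceLaw p _) (integrable_faceLaw p _),
      integral_add (integrable_faceLaw p _) (integrable_faceLaw p _), integral_const_mul,
      integral_const_mul, h₁]
    simp [binomialMoment]
  have h₃ : (faceLaw n k p).real {X | isolatedFaces k X = ∅} * M ^ 2 =
      ∫ X, Set.indicator {X | isolatedFaces k X = ∅} (fun _ => M ^ 2) X ∂(faceLaw n k p) := by
    rw [integral_indicator_const _ .of_discrete, smul_eq_mul]
  have h₄ : ∫ X, Set.indicator {X | isolatedFaces k X = ∅} (fun _ => M ^ 2) X ∂(faceLaw n k p) ≤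
      2 * binomialMoment n k p 2 + (1 - 2 * M) * M + M ^ 2 := by
    rw [← h₂]
    refine integral_mono (integrable_faceLaw p _) (integrable_faceLaw p _) fun X => ?_
    by_cases hX : isolatedFaces k X = ∅
    · simp [hX]
    · simp only [Set.indicator, Set.mem_ofPred_eq, hX, if_false, Nat.cast_choose_two,
        Nat.choose_one_right]
      nlinarith [sq_nonneg (((isolatedFaces k X).card : ℝ) - M)]
  rw [h₃]
  linarith

end Probability

/-! ### Small clusters in links are unlikely. -/

section SmallClusters

theorem card_crossing_cofaces {τ B : Finset (Fin n)} (hτB : Disjoint τ B) :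
    ((B ×ˢ (τ ∪ B)ᶜ).image fun x => insert x.1 (insert x.2 τ)).card =
      B.card * (n - τ.card - B.card) := by
  rw [Finset.card_image_of_injOn, Finset.card_product, Finset.card_compl, Fintype.card_fin,
    Finset.card_union_of_disjoint hτB, Nat.sub_sub]
  rintro ⟨v, z⟩ h ⟨v', z'⟩ h' he
  simp only [Finset.coe_product, Set.mem_prod, Finset.mem_coe, Finset.mem_compl,
    Finset.mem_union, not_or] at h h'
  simp only at he
  have hvτ := Finset.disjoint_right.1 hτB h.1
  have h₁ : v ∈ insert v' (insert z' τ) := he ▸ Finset.mem_insert_self _ _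
  have h₂ : z ∈ insert v' (insert z' τ) :=
    he ▸ Finset.mem_insert_of_mem (Finset.mem_insert_self _ _)
  simp only [Finset.mem_insert] at h₁ h₂
  grind

/-- The required edge lies inside `B` and the forbidden ones leave `B`, so they are different
k-faces and independence gives equality. The factor p is essential when k = 1: there it alone makes
the union bound tend to 0. -/
theorem faceLaw_real_cluster_le (p : unitInterval) {τ B : Finset (Fin n)} (hτ : τ.card + 1 = k)
    (hτB : Disjoint τ B) {u w : Fin n} (hu : u ∈ B) (hw : w ∈ B) (huw : u ≠ w) :
    (faceLaw n k p).real {X | insert u (insert w τ) ∈ X ∧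
        ∀ v ∈ B, ∀ z, z ∉ B → z ∉ τ → insert v (insert z τ) ∉ X} =
      p * (1 - p : ℝ) ^ (B.card * (n - τ.card - B.card)) := by
  have hcard : ∀ v z : Fin n, v ∉ τ → z ∉ τ → v ≠ z → (insert v (insert z τ)).card = k + 1 := by
    intro v z hv hz hvz
    rw [Finset.card_insert_of_notMem (by simp [hv, hvz]), Finset.card_insert_of_notMem hz, hτ]
  have hB : ∀ v ∈ B, v ∉ τ := fun v hv => Finset.disjoint_right.1 hτB hv
  have h := faceLaw_real_subset_disjoint (k := k) p (S := {insert u (insert w τ)})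
    (T := (B ×ˢ (τ ∪ B)ᶜ).image fun x => insert x.1 (insert x.2 τ)) ?_ ?_ ?_
  · rw [card_crossing_cofaces hτB, Finset.card_singleton, pow_one] at h
    rw [← h]
    congr 1
    ext X
    simp only [Set.mem_ofPred_eq, Finset.mem_singleton, forall_eq, Finset.mem_image,
      Finset.mem_product, Finset.mem_compl, Finset.mem_union, Prod.exists, not_or]
    refine and_congr_right fun _ => ⟨?_, fun h v hv z hzB hzτ => ?_⟩
    · rintro h _ ⟨v, z, ⟨hv, hzτ, hzB⟩, rfl⟩
      exact h v hv z hzB hzτ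
    · exact h _ ⟨v, z, ⟨hv, hzτ, hzB⟩, rfl⟩
  · intro σ hσ
    rw [Finset.mem_singleton.1 hσ]
    exact hcard u w (hB u hu) (hB w hw) huw
  · intro σ hσ
    obtain ⟨⟨v, z⟩, hvz, rfl⟩ := Finset.mem_image.1 hσ
    simp only [Finset.mem_product, Finset.mem_compl, Finset.mem_union, not_or] at hvz
    exact hcard v z (hB v hvz.1) hvz.2.1 (fun h => hvz.2.2 (h ▸ hvz.1))
  · rw [Finset.disjoint_singleton_left]
    intro hmem
    obtain ⟨⟨v, z⟩, hvz, he⟩ := Finset.mem_image.1 hmem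
    simp only [Finset.mem_product, Finset.mem_compl, Finset.mem_union, not_or] at hvz
    have : z ∈ insert u (insert w τ) :=
      he ▸ Finset.mem_insert_of_mem (Finset.mem_insert_self _ _)
    simp only [Finset.mem_insert] at this
    grind

/-- The union bound for small clusters. -/
theorem faceLaw_real_hasSmallCluster_le (hk : 1 ≤ k) (p : unitInterval) :
    (faceLaw n k p).real {X | HasSmallCluster k X} ≤
      (n.choose (k - 1) : ℝ) * ∑ b ∈ Finset.range (n - (k - 1) + 1),
        ((n - (k - 1)).choose b : ℝ) * if 2 ≤ b ∧ 2 * b ≤ n - (k - 1) then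
          (b : ℝ) ^ 2 * (p * (1 - p : ℝ) ^ (b * (n - (k - 1) - b))) else 0 := by
  classical
  -- `f b` bounds the contribution of one pair (τ, B) with |B| = b: b² counts the ordered pairs (u,
  -- w), and b ≥ 2 since `B` spans an edge.
  set f : ℕ → ℝ := fun b => if 2 ≤ b ∧ 2 * b ≤ n - (k - 1) then
          (b : ℝ) ^ 2 * (p * (1 - p : ℝ) ^ (b * (n - (k - 1) - b))) else 0 with hf
  have hp0 : (0 : ℝ) ≤ p := p.2.1
  have hp1 : (0 : ℝ) ≤ 1 - p := by linarith [p.2.2]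
  set E : Finset (Fin n) → Finset (Fin n) → Set (Set (Finset (Fin n))) := fun τ B =>
    {X | Disjoint τ B ∧ 2 * B.card ≤ n - τ.card ∧
    (∃ u ∈ B, ∃ w ∈ B, u ≠ w ∧ insert u (insert w τ) ∈ X) ∧
    ∀ v ∈ B, ∀ z, z ∉ B → z ∉ τ → insert v (insert z τ) ∉ X} with hE
  have hEle : ∀ τ B : Finset (Fin n), τ.card = k - 1 → Disjoint τ B →
      (faceLaw n k p).real (E τ B) ≤ f B.card := by
    intro τ B hτ hτB
    by_cases hb : 2 ≤ B.card ∧ 2 * B.card ≤ n - (k - 1)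
    · have hsub : E τ B ⊆ ⋃ u ∈ B, ⋃ w ∈ B, {X | u ≠ w ∧ insert u (insert w τ) ∈ X ∧
        ∀ v ∈ B, ∀ z, z ∉ B → z ∉ τ → insert v (insert z τ) ∉ X} := by
        rintro X ⟨-, -, ⟨u, hu, w, hw, huw, hX⟩, h⟩
        simp only [Set.mem_iUnion]
        exact ⟨u, hu, w, hw, huw, hX, h⟩
      refine (faceLaw_real_mono p hsub).trans ((measureReal_biUnion_finset_le _ _).trans ?_)
      have h₁ : ∀ u ∈ B, (faceLaw n k p).real (⋃ w ∈ B, {X | u ≠ w ∧ insert u (insert w τ) ∈ X ∧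
          ∀ v ∈ B, ∀ z, z ∉ B → z ∉ τ → insert v (insert z τ) ∉ X}) ≤
          B.card * (p * (1 - p : ℝ) ^ (B.card * (n - (k - 1) - B.card))) := by
        intro u hu
        refine (measureReal_biUnion_finset_le _ _).trans ?_
        rw [← nsmul_eq_mul]
        refine Finset.sum_le_card_nsmul _ _ _ fun w hw => ?_
        by_cases huw : u = w
        · simp only [huw, ne_eq, not_true_eq_false, false_and, Set.ofPred_false, measureReal_empty]
          positivity
        · rw [← hτ, ← faceLaw_real_cluster_le p (k := k) (by omega) hτB hu hw huw]
          exact faceLaw_real_mono p fun X hX => hX.2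
      refine (Finset.sum_le_card_nsmul _ _ _ h₁).trans ?_
      simp only [hf, hb, and_self, if_true, nsmul_eq_mul]
      exact le_of_eq (by ring)
    · have : E τ B = ∅ := by
        refine Set.eq_empty_of_forall_notMem fun X hX => hb ?_
        obtain ⟨-, h, ⟨u, hu, w, hw, huw, -⟩, -⟩ := hX
        exact ⟨Finset.one_lt_card.2 ⟨u, hu, w, hw, huw⟩, hτ ▸ h⟩
      rw [this, measureReal_empty]
      simp only [hf]
      split_ifs
      positivity
  have hsub : {X | HasSmallCluster k X} ⊆ ⋃ τ ∈ Finset.powersetCard (k - 1)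
      (Finset.univ : Finset (Fin n)), ⋃ B ∈ τᶜ.powerset, E τ B := by
    rintro X ⟨τ, B, hτ, h, h'⟩
    simp only [Set.mem_iUnion]
    refine ⟨τ, Finset.mem_powersetCard.2 ⟨Finset.subset_univ _, by omega⟩, B,
      Finset.mem_powerset.2 fun v hv => ?_, h, h'⟩
    exact Finset.mem_compl.2 (Finset.disjoint_right.1 h hv)
  refine (faceLaw_real_mono p hsub).trans ((measureReal_biUnion_finset_le _ _).trans ?_)
  refine (Finset.sum_le_card_nsmul _ _ (∑ b ∈ Finset.range (n - (k - 1) + 1),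
    ((n - (k - 1)).choose b : ℝ) * f b) fun τ hτ => ?_).trans ?_
  · have hτ := (Finset.mem_powersetCard.1 hτ).2
    refine (measureReal_biUnion_finset_le _ _).trans ?_
    refine (Finset.sum_le_sum fun B hB => hEle τ B hτ ?_).trans ?_
    · exact Finset.disjoint_right.2 fun v hv => Finset.mem_compl.1 (Finset.mem_powerset.1 hB hv)
    · rw [Finset.sum_powerset_apply_card, Finset.card_compl, Fintype.card_fin, hτ]
      simp
  · simp [hf]

/-- The map x ↦ x·exp(-xM) decreases once xM ≥ 1. This reduces every p above the window to its lower
end. -/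
theorem mul_exp_neg_le_of_le {p₀ p M : ℝ} (hp₀ : 0 < p₀) (h : p₀ ≤ p) (hM : 1 ≤ p₀ * M) :
    p * Real.exp (-(p * M)) ≤ p₀ * Real.exp (-(p₀ * M)) := by
  have h₁ : p / p₀ ≤ Real.exp ((p - p₀) * M) := by
    refine le_trans ?_ (Real.add_one_le_exp _)
    rw [div_le_iff₀ hp₀]
    nlinarith
  have h₂ : p ≤ p₀ * Real.exp ((p - p₀) * M) := by
    rwa [div_le_iff₀ hp₀, mul_comm] at h₁
  calc p * Real.exp (-(p * M)) ≤ p₀ * Real.exp ((p - p₀) * M) * Real.exp (-(p * M)) := by gcongr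
    _ = p₀ * Real.exp (-(p₀ * M)) := by rw [mul_assoc, ← Real.exp_add]; ring_nf

/-- Split log x = log b + log(x/b): the first part is weighted by b/x ≤ 1/2, and (log t)/t ≤ 1 for t
= x/b. -/
theorem mul_log_div_le {x b : ℝ} (hb : 1 ≤ b) (hx : 2 * b ≤ x) :
    b * Real.log x / x ≤ Real.log b / 2 + 1 := by
  have hb0 : 0 < b := by linarith
  have hx0 : 0 < x := by linarith
  have ht : 2 ≤ x / b := by rw [le_div_iff₀ hb0]; exact hx
  have h₁ : Real.log x = Real.log b + Real.log (x / b) := by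
    rw [Real.log_div hx0.ne' hb0.ne']; ring
  have h₂ := Real.log_le_sub_one_of_pos (show 0 < x / b by positivity)
  have h₃ := Real.log_nonneg hb
  rw [div_le_iff₀ hx0]
  have h₄ : x = b * (x / b) := by field_simp
  generalize x / b = t at *
  rw [h₁, h₄]
  nlinarith [mul_nonneg h₃ (by linarith : (0:ℝ) ≤ t - 2)]

/-- Square root of b^b ≤ b!·e^b. -/
theorem exp_mul_log_div_two_le (b : ℕ) :
    Real.exp (b * Real.log b / 2) ≤ Real.sqrt (b.factorial) * Real.exp (b / 2) := by
  rcases Nat.eq_zero_or_pos b with rfl | hb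
  · simp
  have hb' : (0 : ℝ) < b := by exact_mod_cast hb
  have h₁ := Real.pow_div_factorial_le_exp (b : ℝ) hb'.le b
  rw [div_le_iff₀ (by positivity)] at h₁
  refine (sq_le_sq₀ (by positivity) (by positivity)).1 ?_
  rw [mul_pow, Real.sq_sqrt (by positivity), ← Real.exp_nat_mul, ← Real.exp_nat_mul]
  have h₂ : Real.exp ((2 : ℕ) * (b * Real.log b / 2)) = (b : ℝ) ^ b := by
    rw [← Real.exp_log hb', ← Real.exp_nat_mul, Real.log_exp]
    simp only [Real.exp_log hb']
    push_cast
    ring_nf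
  have h₃ : ((2 : ℕ) : ℝ) * (b / 2) = b := by push_cast; ring
  rw [h₂, h₃]
  linarith

theorem summable_pow_div_sqrt_factorial (D : ℝ) (hD : 0 ≤ D) :
    Summable fun b : ℕ => D ^ b / Real.sqrt b.factorial := by
  have h₁ := Real.summable_pow_div_factorial (4 * D ^ 2)
  have h₂ : Summable fun b : ℕ => (1 / 4 : ℝ) ^ b :=
    summable_geometric_of_lt_one (by norm_num) (by norm_num)
  refine Summable.of_nonneg_of_le (fun b => by positivity) (fun b => ?_) (h₁.add h₂)
  have hs : 0 < Real.sqrt b.factorial := Real.sqrt_pos.2 (by positivity)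
  -- The product of these two factors is at most the sum of their squares, and both squares are
  -- summable.
  have e₁ : D ^ b / Real.sqrt b.factorial = ((2 * D) ^ b / Real.sqrt b.factorial) * (1 / 2) ^ b := by
    rw [div_mul_eq_mul_div, ← mul_pow]; ring_nf
  have e₂ : (4 * D ^ 2) ^ b / (b.factorial : ℝ) = ((2 * D) ^ b / Real.sqrt b.factorial) ^ 2 := by
    rw [div_pow, Real.sq_sqrt (by positivity), ← pow_mul, mul_comm b 2, pow_mul]; ring_nf
  have e₃ : (1 / 4 : ℝ) ^ b = ((1 / 2) ^ b) ^ 2 := by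
    rw [← pow_mul, mul_comm b 2, pow_mul]; norm_num
  rw [e₁, e₂, e₃]
  nlinarith [sq_nonneg ((2 * D) ^ b / Real.sqrt b.factorial - (1 / 2) ^ b),
    sq_nonneg ((2 * D) ^ b / Real.sqrt b.factorial), sq_nonneg ((1 / 2 : ℝ) ^ b)]

/-- The main terms add up to -(k-1)(b-1) log n. The correction from b(n-(k-1)-b) falling short of bn
splits into three parts: one absorbed by that main term, since b²/n ≤ b/2 ≤ b - 1 for b ≥ 2; one
bounded by `mul_log_div_le`; and one at most b. What remains, b log b / 2, costs only half of the
1/b! in the union bound. -/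
theorem cluster_exponent_le {k n b d : ℝ} (hk : 1 ≤ k) (hd : 0 ≤ d) (hb : 2 ≤ b)
    (hbn : 2 * b ≤ n - (k - 1)) (hL : 0 ≤ Real.log n) (hlog : k ^ 2 * Real.log n ≤ n) :
    (k - 1) * Real.log n + b * Real.log n -
        (k * Real.log n - d) / n * (b * (n - (k - 1) - b)) ≤
      b * Real.log b / 2 + (d + 2) * b := by
  have hn0 : 0 < n := by linarith
  have e₄ := mul_log_div_le (b := b) (x := n) (by linarith) (by linarith)
  generalize Real.log n = L at *
  have e₁ : (k * L - d) / n * (b * (n - (k - 1) - b)) =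
      (k * L - d) * b - (k * L - d) * b * (b + (k - 1)) / n := by
    field_simp; ring
  have e₂ : (k * L - d) * b * (b + (k - 1)) / n ≤ k * L * b * (b + (k - 1)) / n := by
    have h₁ : (k * L - d) ≤ k * L := by linarith
    have h₂ : 0 ≤ b + (k - 1) := by linarith
    gcongr
  have e₃ : k * L * b * (b + (k - 1)) / n =
      (k - 1) * L * (b ^ 2 / n) + b * (b * L / n) + (k * (k - 1) * L / n) * b := by
    field_simp; ring
  have e₅ : b ^ 2 / n ≤ b - 1 := by
    rw [div_le_iff₀ hn0]; nlinarith
  have e₆ : k * (k - 1) * L / n ≤ 1 := by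
    rw [div_le_one hn0]; nlinarith
  have e₇ : (k - 1) * L * (b ^ 2 / n) ≤ (k - 1) * L * (b - 1) :=
    mul_le_mul_of_nonneg_left e₅ (mul_nonneg (by linarith) hL)
  have e₈ : b * (b * L / n) ≤ b * (Real.log b / 2 + 1) :=
    mul_le_mul_of_nonneg_left e₄ (by linarith)
  have e₉ : (k * (k - 1) * L / n) * b ≤ 1 * b := mul_le_mul_of_nonneg_right e₆ (by linarith)
  rw [e₁]
  linarith

theorem sq_div_factorial_mul_exp_le {d : ℝ} (b : ℕ) :
    (b : ℝ) ^ 2 / b.factorial * Real.exp (b * Real.log b / 2 + (d + 2) * b) ≤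
      (4 * Real.exp (d + 3)) ^ b / Real.sqrt b.factorial := by
  have hs : 0 < Real.sqrt b.factorial := Real.sqrt_pos.2 (by positivity)
  have hbpow : (b : ℝ) ^ 2 ≤ 4 ^ b := by
    have : (b : ℝ) ≤ 2 ^ b := by exact_mod_cast b.lt_two_pow_self.le
    calc (b : ℝ) ^ 2 ≤ (2 ^ b) ^ 2 := by gcongr
      _ = 4 ^ b := by rw [← pow_mul, mul_comm, pow_mul]; norm_num
  have e : (b.factorial : ℝ) = Real.sqrt b.factorial * Real.sqrt b.factorial :=
    (Real.mul_self_sqrt (by positivity)).symm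
  have h := exp_mul_log_div_two_le b
  rw [Real.exp_add, mul_pow, ← Real.exp_nat_mul]
  calc (b : ℝ) ^ 2 / b.factorial * (Real.exp (b * Real.log b / 2) * Real.exp ((d + 2) * b))
      ≤ 4 ^ b / b.factorial *
        (Real.sqrt b.factorial * Real.exp (b / 2) * Real.exp ((d + 2) * b)) := by gcongr
    _ = 4 ^ b * (Real.exp (b / 2 + (d + 2) * b)) / Real.sqrt b.factorial := by
      rw [Real.exp_add]
      nth_rewrite 1 [e]
      field_simp
    _ ≤ _ := by
      gcongr
      have : (0 : ℝ) ≤ b := by positivity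
      linarith

theorem mul_one_sub_pow_le {p₀ p : ℝ} {m : ℕ} (hp₀ : 0 < p₀) (h : p₀ ≤ p) (hp : p ≤ 1)
    (hm : 1 ≤ p₀ * m) : p * (1 - p) ^ m ≤ p₀ * Real.exp (-(p₀ * m)) := by
  refine le_trans ?_ (mul_exp_neg_le_of_le hp₀ h hm)
  refine mul_le_mul_of_nonneg_left ?_ (hp₀.le.trans h)
  calc (1 - p) ^ m ≤ Real.exp (-p) ^ m :=
        pow_le_pow_left₀ (by linarith) (Real.one_sub_le_exp_neg p) _
    _ = Real.exp (-(p * m)) := by rw [← Real.exp_nat_mul]; ring_nf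

/-- A single term of the union bound. -/
theorem cluster_term_le (hk : 1 ≤ k) {d p : ℝ} (hd : 0 ≤ d) (hp : p ≤ 1)
    (hlow : (k * Real.log n - d) / n ≤ p) (hn : 2 * k ≤ n) (hlog : d + 2 ≤ k * Real.log n)
    (hlog' : k ^ 2 * Real.log n ≤ n) {b : ℕ} (hb : 2 ≤ b) (hbn : 2 * b ≤ n - (k - 1)) :
    (n : ℝ) ^ (k - 1) * ((n : ℝ) ^ b / b.factorial *
        ((b : ℝ) ^ 2 * (p * (1 - p) ^ (b * (n - (k - 1) - b))))) ≤
      k * Real.log n / n * ((4 * Real.exp (d + 3)) ^ b / Real.sqrt b.factorial) := by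
  have hn0 : (0 : ℝ) < n := by exact_mod_cast (by omega : 0 < n)
  have hk' : (1 : ℝ) ≤ k := by exact_mod_cast hk
  have hb' : (2 : ℝ) ≤ b := by exact_mod_cast hb
  have hnk : 2 * (k : ℝ) ≤ n := by exact_mod_cast hn
  have hpow : ∀ j : ℕ, (n : ℝ) ^ j = Real.exp (j * Real.log n) := fun j => by
    rw [Real.exp_nat_mul, Real.exp_log hn0]
  have hL0 : 0 ≤ Real.log n := Real.log_natCast_nonneg n
  have hM : ((b * (n - (k - 1) - b) : ℕ) : ℝ) = b * (n - (k - 1) - b) := by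
    rw [Nat.cast_mul, Nat.cast_sub (by omega), Nat.cast_sub (by omega), Nat.cast_sub hk]
    simp
  have hbn' : 2 * (b : ℝ) ≤ n - (k - 1) := by
    have h₁ : 2 * b + k ≤ n + 1 := by omega
    have h₂ : 2 * (b : ℝ) + k ≤ n + 1 := by exact_mod_cast h₁
    linarith
  have hexp := cluster_exponent_le hk' hd hb' hbn' hL0 hlog'
  rw [← hM] at hexp
  have hp₀n : (k * Real.log n - d) / n * n = k * Real.log n - d := by field_simp
  have hp₀0 : 0 < (k * Real.log n - d) / n := div_pos (by linarith) hn0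
  have hp₀le : (k * Real.log n - d) / n ≤ k * Real.log n / n := by gcongr; linarith
  -- The number of crossing pairs is at least n - (k-1) ≥ n/2, so the product is at least (k log n -
  -- d)/2 ≥ 1.
  have hM1 : 1 ≤ (k * Real.log n - d) / n * (b * (n - (k - 1) - b) : ℕ) := by
    have h₁ : (n : ℝ) / 2 ≤ (b * (n - (k - 1) - b) : ℕ) := by rw [hM]; nlinarith
    have h₂ := mul_le_mul_of_nonneg_left h₁ hp₀0.le
    linarith
  have h₁ := mul_one_sub_pow_le hp₀0 hlow hp hM1
  generalize (k * Real.log n - d) / n = p₀ at *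
  generalize b * (n - (k - 1) - b) = M at *
  calc (n : ℝ) ^ (k - 1) * ((n : ℝ) ^ b / b.factorial * ((b : ℝ) ^ 2 * (p * (1 - p) ^ M)))
      ≤ (n : ℝ) ^ (k - 1) * ((n : ℝ) ^ b / b.factorial *
        ((b : ℝ) ^ 2 * (p₀ * Real.exp (-(p₀ * M))))) := by gcongr
    _ = p₀ * ((b : ℝ) ^ 2 / b.factorial *
        Real.exp ((k - 1) * Real.log n + b * Real.log n - p₀ * M)) := by
      rw [hpow, hpow, sub_eq_add_neg, Real.exp_add, Real.exp_add, Nat.cast_sub hk, Nat.cast_one]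
      ring
    _ ≤ k * Real.log n / n *
        ((b : ℝ) ^ 2 / b.factorial * Real.exp (b * Real.log b / 2 + (d + 2) * b)) := by
      gcongr
    _ ≤ _ := mul_le_mul_of_nonneg_left (sq_div_factorial_mul_exp_le b) (by positivity)

/-- At and above the threshold window, small clusters are unlikely. -/
theorem exists_faceLaw_real_hasSmallCluster_le (hk : 1 ≤ k) (c : ℝ) :
    ∃ K : ℝ, ∀ᶠ n : ℕ in atTop, ∀ p : unitInterval, (k * Real.log n + c) / n ≤ (p : ℝ) →
      (faceLaw n k p).real {X | HasSmallCluster k X} ≤ K * (Real.log n / n) := by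
  -- Replacing c by -|c| only lowers the bound on p and makes the deficit d nonnegative.
  set d := |c| with hd
  have hsum := summable_pow_div_sqrt_factorial (4 * Real.exp (d + 3)) (by positivity)
  refine ⟨k * ∑' b : ℕ, (4 * Real.exp (d + 3)) ^ b / Real.sqrt b.factorial, ?_⟩
  have hk' : (1 : ℝ) ≤ k := by exact_mod_cast hk
  have hlogtop : Tendsto (fun n : ℕ => Real.log n) atTop atTop :=
    Real.tendsto_log_atTop.comp tendsto_natCast_atTop_atTop
  have hlogo : Tendsto (fun n : ℕ => (k : ℝ) ^ 2 * (Real.log n / n)) atTop (𝓝 ((k : ℝ) ^ 2 * 0)) := by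
    refine Tendsto.const_mul _ ?_
    have := (Real.isLittleO_log_id_atTop.tendsto_div_nhds_zero).comp tendsto_natCast_atTop_atTop
    exact this
  rw [mul_zero] at hlogo
  filter_upwards [eventually_ge_atTop (2 * k), hlogtop.eventually_ge_atTop (d + 2),
    hlogo.eventually_le_const zero_lt_one] with n hn hlog hlog' p hp
  have hn0 : (0 : ℝ) < n := by exact_mod_cast (by omega : 0 < n)
  have hL0 : 0 ≤ Real.log n := Real.log_natCast_nonneg n
  refine (faceLaw_real_hasSmallCluster_le hk p).trans ?_
  have hterm : ∀ b ∈ Finset.range (n - (k - 1) + 1),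
      (n.choose (k - 1) : ℝ) * (((n - (k - 1)).choose b : ℝ) *
        if 2 ≤ b ∧ 2 * b ≤ n - (k - 1) then
          (b : ℝ) ^ 2 * (p * (1 - p : ℝ) ^ (b * (n - (k - 1) - b))) else 0) ≤
      k * Real.log n / n * ((4 * Real.exp (d + 3)) ^ b / Real.sqrt b.factorial) := by
    intro b _
    split_ifs with hb
    · refine le_trans ?_ (cluster_term_le hk (d := d) (p := p) (abs_nonneg c) p.2.2 ?_ hn ?_ ?_
        hb.1 hb.2)
      · have hq : (0 : ℝ) ≤ 1 - p := by linarith [p.2.2]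
        have hp0 : (0 : ℝ) ≤ p := p.2.1
        have h₁ : (n.choose (k - 1) : ℝ) ≤ (n : ℝ) ^ (k - 1) := by
          exact_mod_cast Nat.choose_le_pow n (k - 1)
        have h₂ : ((n - (k - 1)).choose b : ℝ) ≤ (n : ℝ) ^ b / b.factorial := by
          refine (Nat.choose_le_pow_div b (n - (k - 1))).trans ?_
          gcongr
          exact Nat.sub_le _ _
        gcongr
      · refine le_trans ?_ hp
        gcongr
        have := neg_abs_le c
        linarith
      · nlinarith
      · rw [← mul_div_assoc, div_le_one hn0] at hlog'
        exact hlog'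
    · rw [mul_zero, mul_zero]
      positivity
  rw [Finset.mul_sum]
  refine (Finset.sum_le_sum hterm).trans ?_
  rw [← Finset.mul_sum]
  have := hsum.sum_le_tsum (Finset.range (n - (k - 1) + 1)) (fun b _ => by positivity)
  calc _ ≤ k * Real.log n / n * _ := mul_le_mul_of_nonneg_left this (by positivity)
    _ = _ := by ring

theorem tendsto_faceLaw_real_hasSmallCluster (hk : 1 ≤ k) (c : ℝ) (p : ℕ → unitInterval)
    (hp : ∀ᶠ n : ℕ in atTop, (k * Real.log n + c) / n ≤ (p n : ℝ)) :
    Tendsto (fun n => (faceLaw n k (p n)).real {X | HasSmallCluster k X}) atTop (𝓝 0) := by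
  obtain ⟨K, hK⟩ := exists_faceLaw_real_hasSmallCluster_le hk c
  have hlogo : Tendsto (fun n : ℕ => K * (Real.log n / n)) atTop (𝓝 (K * 0)) :=
    ((Real.isLittleO_log_id_atTop.tendsto_div_nhds_zero).comp
      tendsto_natCast_atTop_atTop).const_mul _
  rw [mul_zero] at hlogo
  refine squeeze_zero' (.of_forall fun n => measureReal_nonneg) ?_ hlogo
  filter_upwards [hK, hp] with n h₁ h₂ using h₁ _ h₂

end SmallClusters

/-! ### Poisson limit by the method of binomial moments. -/

section Poisson

/-- Bonferroni: the truncation error is at most the first omitted term. For w = j + m + 1 each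
summand factors as C(w,j)·C(m+1,i), the alternating partial sum is (-1)^I·C(m,I), and C(m,I) ≤
C(m+1,I+1) by Pascal's rule. -/
theorem abs_bonferroni_sub_le (w j I : ℕ) :
    |(if w = j then 1 else 0 : ℝ) -
        ∑ i ∈ Finset.range (I + 1), (-1 : ℝ) ^ i * ((j + i).choose j * w.choose (j + i))| ≤
      (j + (I + 1)).choose j * w.choose (j + (I + 1)) := by
  rcases lt_trichotomy w j with h | rfl | h
  · rw [if_neg h.ne, Finset.sum_eq_zero]
    · simp only [sub_zero, abs_zero]; positivity
    · intro i _
      rw [Nat.choose_eq_zero_of_lt (show w < j + i by omega)]; simp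
  · rw [if_pos rfl, Finset.sum_eq_single 0]
    · simp only [add_zero, Nat.choose_self, pow_zero, Nat.cast_one, mul_one, sub_self, abs_zero]
      positivity
    · intro i _ hi
      rw [Nat.choose_eq_zero_of_lt (show w < w + i by omega)]; simp
    · simp
  · obtain ⟨m, rfl⟩ : ∃ m, w = j + (m + 1) := ⟨w - j - 1, by omega⟩
    have key : ∀ i, ((j + i).choose j : ℝ) * (j + (m + 1)).choose (j + i) =
        (j + (m + 1)).choose j * (m + 1).choose i := by
      intro i
      have := Nat.choose_mul (n := j + (m + 1)) (Nat.le_add_right j i)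
      rw [Nat.add_sub_cancel_left, Nat.add_sub_cancel_left] at this
      rw [mul_comm]
      exact_mod_cast this
    rw [if_neg (by omega), key]
    simp_rw [key]
    have h₁ : ∑ i ∈ Finset.range (I + 1),
        (-1 : ℝ) ^ i * ((j + (m + 1)).choose j * (m + 1).choose i) =
        (j + (m + 1)).choose j * ((-1) ^ I * m.choose I) := by
      have h₂ := congrArg (fun z : ℤ => (z : ℝ))
        (Int.alternating_sum_range_choose_eq_choose (n := m) (m := I))
      push_cast at h₂
      rw [← h₂, Finset.mul_sum]
      exact Finset.sum_congr rfl fun i _ => by ring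
    rw [h₁, zero_sub, abs_neg, abs_mul, abs_mul, abs_pow, abs_neg, abs_one, one_pow, one_mul,
      Nat.abs_cast, Nat.abs_cast]
    gcongr
    rw [Nat.choose_succ_succ]
    exact Nat.le_add_right _ _

theorem abs_faceLaw_real_card_eq_sub_le (p : unitInterval) (j I : ℕ) :
    |(faceLaw n k p).real {X | (isolatedFaces k X).card = j} -
        ∑ i ∈ Finset.range (I + 1),
          (-1 : ℝ) ^ i * ((j + i).choose j * binomialMoment n k p (j + i))| ≤
      (j + (I + 1)).choose j * binomialMoment n k p (j + (I + 1)) := by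
  have h₁ : (faceLaw n k p).real {X | (isolatedFaces k X).card = j} =
      ∫ X, (if (isolatedFaces k X).card = j then 1 else 0 : ℝ) ∂(faceLaw n k p) := by
    rw [← integral_indicator_one .of_discrete]
    simp only [Set.indicator_apply, Set.mem_ofPred_eq, Pi.one_apply]
  have h₂ : ∑ i ∈ Finset.range (I + 1),
      (-1 : ℝ) ^ i * ((j + i).choose j * binomialMoment n k p (j + i)) =
      ∫ X, ∑ i ∈ Finset.range (I + 1), (-1 : ℝ) ^ i *
        ((j + i).choose j * (isolatedFaces k X).card.choose (j + i)) ∂(faceLaw n k p) := by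
    rw [integral_finsetSum _ fun _ _ => integrable_faceLaw p _]
    simp_rw [integral_const_mul]
    rfl
  rw [h₁, h₂, ← integral_sub (integrable_faceLaw p _) (integrable_faceLaw p _), binomialMoment,
    ← integral_const_mul]
  refine (abs_integral_le_integral_abs).trans ?_
  exact integral_mono (integrable_faceLaw p _) (integrable_faceLaw p _)
    fun X => abs_bonferroni_sub_le _ _ _

/-- Convergence of all binomial moments to those of a Poisson variable implies convergence of the
point probabilities. -/
theorem tendsto_of_tendsto_binomial_moments {P : ℕ → ℝ} {M : ℕ → ℕ → ℝ} {l : ℝ} (j : ℕ)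
    (hP : ∀ n I, |P n - ∑ i ∈ Finset.range (I + 1),
        (-1 : ℝ) ^ i * ((j + i).choose j * M n (j + i))| ≤
      (j + (I + 1)).choose j * M n (j + (I + 1)))
    (hM : ∀ r, Tendsto (fun n => M n r) atTop (𝓝 (l ^ r / r.factorial))) :
    Tendsto P atTop (𝓝 (Real.exp (-l) * l ^ j / j.factorial)) := by
  have key : ∀ i, ((j + i).choose j : ℝ) * (l ^ (j + i) / (j + i).factorial) =
      l ^ j / j.factorial * (l ^ i / i.factorial) := by
    intro i
    have := Nat.add_choose_mul_factorial_mul_factorial j i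
    have h : ((j + i).choose j : ℝ) * j.factorial * i.factorial = (j + i).factorial := by
      rw [← Nat.choose_symm_add] at this
      exact_mod_cast this
    rw [← h, pow_add]
    have : ((j + i).choose j : ℝ) ≠ 0 := by
      exact_mod_cast (Nat.choose_pos (Nat.le_add_right j i)).ne'
    field_simp
  set L := Real.exp (-l) * l ^ j / j.factorial with hL
  set S : ℕ → ℝ := fun I => ∑ i ∈ Finset.range (I + 1),
    (-1 : ℝ) ^ i * ((j + i).choose j * (l ^ (j + i) / (j + i).factorial)) with hS
  have hSL : Tendsto S atTop (𝓝 L) := by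
    have h₁ := (NormedSpace.expSeries_div_hasSum_exp (-l)).mul_left (l ^ j / j.factorial)
    have h₂ := (tendsto_add_atTop_iff_nat 1).2 h₁.tendsto_sum_nat
    rw [← Real.exp_eq_exp_ℝ] at h₂
    convert h₂ using 2
    · rename_i I
      refine Finset.sum_congr rfl fun i _ => ?_
      rw [key, neg_pow l i]; ring
    · rw [hL]; ring
  have hrem : Tendsto (fun I => ((j + (I + 1)).choose j : ℝ) *
      (l ^ (j + (I + 1)) / (j + (I + 1)).factorial)) atTop (𝓝 0) := by
    simp_rw [key]
    have := ((tendsto_add_atTop_iff_nat 1).2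
      (FloorSemiring.tendsto_pow_div_factorial_atTop l)).const_mul (l ^ j / (j.factorial : ℝ))
    rwa [mul_zero] at this
  have hF : Tendsto (fun I => ((j + (I + 1)).choose j : ℝ) *
      (l ^ (j + (I + 1)) / (j + (I + 1)).factorial) + |S I - L|) atTop (𝓝 0) := by
    have := hrem.add (hSL.sub_const L).abs
    simpa using this
  rw [Metric.tendsto_atTop']
  intro ε hε
  -- The truncation level is fixed first, using only the limiting moments; then n → ∞ with `I`
  -- fixed.
  obtain ⟨I, hI⟩ := (hF.eventually_lt_const hε).exists
  have hn : Tendsto (fun n => ((j + (I + 1)).choose j : ℝ) * M n (j + (I + 1)) +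
      |∑ i ∈ Finset.range (I + 1), (-1 : ℝ) ^ i * ((j + i).choose j * M n (j + i)) - L|) atTop
      (𝓝 (((j + (I + 1)).choose j : ℝ) *
        (l ^ (j + (I + 1)) / (j + (I + 1)).factorial) + |S I - L|)) := by
    refine ((hM _).const_mul _).add ((Tendsto.sub_const ?_ L).abs)
    exact tendsto_finsetSum _ fun i _ => ((hM _).const_mul _).const_mul _
  obtain ⟨n₀, h₀⟩ := eventually_atTop.1 (hn.eventually_lt_const hI)
  refine ⟨n₀, fun n hn => ?_⟩
  refine lt_of_le_of_lt ?_ (h₀ n hn.le)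
  rw [Real.dist_eq]
  refine (abs_sub_le _ (∑ i ∈ Finset.range (I + 1),
    (-1 : ℝ) ^ i * ((j + i).choose j * M n (j + i))) _).trans ?_
  gcongr
  exact hP n I

theorem tendsto_choose_mul_pow {N : ℕ → ℕ} {x : ℕ → ℝ} {l : ℝ} (hN : Tendsto N atTop atTop)
    (h : Tendsto (fun n => (N n : ℝ) * x n) atTop (𝓝 l)) (r : ℕ) :
    Tendsto (fun n => ((N n).choose r : ℝ) * x n ^ r) atTop (𝓝 (l ^ r / r.factorial)) := by
  have h₁ := ((isEquivalent_choose r).comp_tendsto hN).mul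
    (Asymptotics.IsEquivalent.refl (u := fun n => x n ^ r))
  refine (Asymptotics.IsEquivalent.tendsto_nhds_iff h₁).2 ?_
  refine ((h.pow r).div_const (r.factorial : ℝ)).congr fun n => ?_
  simp only [Pi.mul_apply, Function.comp]
  rw [mul_pow]; ring

theorem tendsto_choose_atTop (hk : 1 ≤ k) : Tendsto (fun n : ℕ => n.choose k) atTop atTop := by
  obtain ⟨j, rfl⟩ : ∃ j, k = j + 1 := ⟨k - 1, by omega⟩
  have h : ∀ m, m ≤ (j + 1 + m).choose (j + 1) := by
    intro m
    induction m with
    | zero => simp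
    | succ m ih =>
      have := Nat.choose_pos (show j ≤ j + 1 + m by omega)
      rw [← add_assoc, Nat.choose_succ_succ']
      omega
  refine tendsto_atTop_mono' _ ?_ (tendsto_sub_atTop_nat (j + 1))
  filter_upwards [eventually_ge_atTop (j + 1)] with n hn
  simpa [Nat.add_sub_cancel' hn] using h (n - (j + 1))

theorem tendsto_choose_div_pow (k : ℕ) :
    Tendsto (fun n : ℕ => (n.choose k : ℝ) / (n : ℝ) ^ k) atTop (𝓝 (1 / k.factorial)) := by
  have h : Tendsto (fun n : ℕ => ((n : ℕ) : ℝ) * (1 / (n : ℝ))) atTop (𝓝 1) := by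
    refine tendsto_const_nhds.congr' ?_
    filter_upwards [eventually_ge_atTop 1] with n hn
    have : (n : ℝ) ≠ 0 := by positivity
    field_simp
  have := tendsto_choose_mul_pow tendsto_id h k
  simpa [div_eq_mul_inv] using this

theorem tendsto_binomialMoment {p : ℕ → unitInterval} {l : ℝ} (hk : 1 ≤ k)
    (hp : Tendsto (fun n => (p n : ℝ)) atTop (𝓝 0))
    (h : Tendsto (fun n : ℕ => (n.choose k : ℝ) * (1 - p n : ℝ) ^ (n - k)) atTop (𝓝 l)) (r : ℕ) :
    Tendsto (fun n => binomialMoment n k (p n) r) atTop (𝓝 (l ^ r / r.factorial)) := by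
  have hlow := tendsto_choose_mul_pow (tendsto_choose_atTop hk) h r
  have hq : Tendsto (fun n => (1 - p n : ℝ) ^ (r ^ 2)) atTop (𝓝 1) := by
    simpa using (hp.const_sub 1).pow (r ^ 2)
  have hup := hlow.div hq one_ne_zero
  rw [div_one] at hup
  refine tendsto_of_tendsto_of_tendsto_of_le_of_le' hlow hup
    (.of_forall fun n => choose_mul_pow_le_binomialMoment _ _) ?_
  filter_upwards [hp.eventually_lt_const zero_lt_one] with n hn
  have : (0 : ℝ) < 1 - p n := by linarith
  exact (le_div_iff₀ (by positivity)).2 (binomialMoment_mul_pow_le _ _)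

/-- Follows from (1 - x)(1 + x + 2x²) = 1 + x²(1 - 2x) ≥ 1. -/
theorem exp_neg_le_one_sub {x : ℝ} (hx : x ≤ 1 / 2) :
    Real.exp (-(x + 2 * x ^ 2)) ≤ 1 - x := by
  have h := Real.add_one_le_exp (x + 2 * x ^ 2)
  rw [Real.exp_neg]
  refine inv_le_of_inv_le₀ (by linarith) (le_trans ?_ h)
  rw [inv_le_iff_one_le_mul₀ (by linarith)]
  nlinarith [mul_nonneg (sq_nonneg x) (by linarith : 0 ≤ 1 - 2 * x)]

theorem pow_mul_one_sub_pow_le {x : ℝ} (hx : x ≤ 1) (hn : 0 < n) :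
    (n : ℝ) ^ k * (1 - x) ^ n ≤ Real.exp (k * Real.log n - n * x) := by
  have hn0 : (0 : ℝ) < n := by exact_mod_cast hn
  rw [sub_eq_add_neg (k * Real.log n), Real.exp_add, Real.exp_nat_mul, Real.exp_log hn0]
  gcongr
  calc (1 - x) ^ n ≤ Real.exp (-x) ^ n :=
        pow_le_pow_left₀ (by linarith) (Real.one_sub_le_exp_neg x) _
    _ = Real.exp (-(n * x)) := by rw [← Real.exp_nat_mul]; ring_nf

theorem le_pow_mul_one_sub_pow {x : ℝ} (hx : x ≤ 1 / 2) (hn : 0 < n) :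
    Real.exp (k * Real.log n - n * x - 2 * (n * x ^ 2)) ≤ (n : ℝ) ^ k * (1 - x) ^ n := by
  have hn0 : (0 : ℝ) < n := by exact_mod_cast hn
  rw [sub_sub, sub_eq_add_neg (k * Real.log n), Real.exp_add, Real.exp_nat_mul, Real.exp_log hn0]
  gcongr
  calc Real.exp (-(n * x + 2 * (n * x ^ 2))) = Real.exp (-(x + 2 * x ^ 2)) ^ n := by
        rw [← Real.exp_nat_mul]; ring_nf
    _ ≤ _ := pow_le_pow_left₀ (Real.exp_nonneg _) (exp_neg_le_one_sub hx) _

theorem tendsto_log_pow_div (j : ℕ) :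
    Tendsto (fun n : ℕ => Real.log n ^ j / n) atTop (𝓝 0) :=
  (Real.isLittleO_pow_log_id_atTop.tendsto_div_nhds_zero).comp tendsto_natCast_atTop_atTop

/-- The limit np² → 0 makes the quadratic error in (1-p)^n ≈ exp(-np) disappear. -/
theorem tendsto_of_le_log {p : ℕ → unitInterval} {a c : ℝ}
    (hp : ∀ᶠ n : ℕ in atTop, (p n : ℝ) ≤ (a * Real.log n + c) / n) :
    Tendsto (fun n => (p n : ℝ)) atTop (𝓝 0) ∧
      Tendsto (fun n : ℕ => n * (p n : ℝ) ^ 2) atTop (𝓝 0) := by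
  have h₁ := tendsto_log_pow_div 1
  have h₂ := tendsto_log_pow_div 2
  have h₀ := tendsto_log_pow_div 0
  constructor
  · refine squeeze_zero' (.of_forall fun n => (p n).2.1) hp ?_
    have := (h₁.const_mul a).add (h₀.const_mul c)
    rw [mul_zero, mul_zero, add_zero] at this
    refine this.congr fun n => ?_
    ring
  · have := ((h₂.const_mul (a ^ 2)).add (h₁.const_mul (2 * a * c))).add (h₀.const_mul (c ^ 2))
    simp only [mul_zero, add_zero] at this
    refine squeeze_zero' (.of_forall fun n => by positivity) ?_ this
    filter_upwards [hp, eventually_ge_atTop 1] with n hn hn1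
    have hn0 : (0 : ℝ) < n := by exact_mod_cast hn1
    calc (n : ℝ) * (p n : ℝ) ^ 2 ≤ n * ((a * Real.log n + c) / n) ^ 2 := by
          have := (p n).2.1
          gcongr
      _ = _ := by field_simp; ring

theorem tendsto_pow_mul_one_sub_pow {p : ℕ → unitInterval} {c : ℝ}
    (hp : ∀ᶠ n : ℕ in atTop, (p n : ℝ) = (k * Real.log n + c) / n) :
    Tendsto (fun n : ℕ => (n : ℝ) ^ k * (1 - p n : ℝ) ^ n) atTop (𝓝 (Real.exp (-c))) := by
  obtain ⟨h₁, h₂⟩ := tendsto_of_le_log (hp.mono fun _ hn => hn.le)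
  have hlow : Tendsto (fun n : ℕ => Real.exp (-c - 2 * (n * (p n : ℝ) ^ 2))) atTop
      (𝓝 (Real.exp (-c))) := by
    have := (h₂.const_mul 2).const_sub (-c)
    rw [mul_zero, sub_zero] at this
    exact (Real.continuous_exp.tendsto _).comp this
  have hnp : ∀ᶠ n : ℕ in atTop, k * Real.log n - n * (p n : ℝ) = -c := by
    filter_upwards [hp, eventually_ge_atTop 1] with n hn hn1
    have hn0 : (0 : ℝ) < n := by exact_mod_cast hn1
    rw [hn]; field_simp; ring
  refine tendsto_of_tendsto_of_tendsto_of_le_of_le' hlow tendsto_const_nhds ?_ ?_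
  · filter_upwards [hnp, eventually_ge_atTop 1,
      h₁.eventually_le_const (show (0 : ℝ) < 1 / 2 by norm_num)] with n hn hn1 hn2
    rw [← hn]
    exact le_pow_mul_one_sub_pow hn2 hn1
  · filter_upwards [hnp, eventually_ge_atTop 1] with n hn hn1
    rw [← hn]
    exact pow_mul_one_sub_pow_le (p n).2.2 hn1

theorem tendsto_choose_mul_one_sub_pow {p : ℕ → unitInterval} {c : ℝ}
    (hp : ∀ᶠ n : ℕ in atTop, (p n : ℝ) = (k * Real.log n + c) / n) :
    Tendsto (fun n : ℕ => (n.choose k : ℝ) * (1 - p n : ℝ) ^ (n - k)) atTop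
      (𝓝 (Real.exp (-c) / k.factorial)) := by
  obtain ⟨h₁, -⟩ := tendsto_of_le_log (hp.mono fun _ hn => hn.le)
  have h := ((tendsto_choose_div_pow k).mul (tendsto_pow_mul_one_sub_pow hp)).div
    ((h₁.const_sub 1).pow k) (by simp)
  simp only [sub_zero, one_pow, div_one] at h
  rw [one_div_mul_eq_div] at h
  refine h.congr' ?_
  filter_upwards [eventually_ge_atTop (k + 1), h₁.eventually_lt_const zero_lt_one] with n hn hp1
  have hn0 : (n : ℝ) ≠ 0 := by
    have : 0 < n := by omega
    positivity
  have hq : (1 - p n : ℝ) ≠ 0 := by linarith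
  simp only [Pi.div_apply]
  rw [pow_sub₀ _ hq (by omega)]
  field_simp

/-- In the threshold window, the number of isolated faces is asymptotically Poisson. -/
theorem tendsto_faceLaw_real_card_isolatedFaces {p : ℕ → unitInterval} {c : ℝ} (hk : 1 ≤ k)
    (hp : ∀ᶠ n : ℕ in atTop, (p n : ℝ) = (k * Real.log n + c) / n) (j : ℕ) :
    Tendsto (fun n => (faceLaw n k (p n)).real {X | (isolatedFaces k X).card = j}) atTop
      (𝓝 (Real.exp (-(Real.exp (-c) / k.factorial)) * (Real.exp (-c) / k.factorial) ^ j /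
        j.factorial)) :=
  tendsto_of_tendsto_binomial_moments j
    (fun n I => abs_faceLaw_real_card_eq_sub_le (p n) j I)
    (tendsto_binomialMoment hk (tendsto_of_le_log (hp.mono fun _ hn => hn.le)).1
      (tendsto_choose_mul_one_sub_pow hp))

/-- Laws on `ℕ` converge weakly as soon as the point probabilities converge. -/
theorem tendsto_probabilityMeasure_nat {μ : ℕ → ProbabilityMeasure ℕ} {ν : ProbabilityMeasure ℕ}
    (h : ∀ j : ℕ, Tendsto (fun n => μ n {j}) atTop (𝓝 (ν {j}))) : Tendsto μ atTop (𝓝 ν) := by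
  refine IsPiSystem.tendsto_probabilityMeasure_of_tendsto_of_mem
    (S := Set.range fun j : ℕ => ({j} : Set ℕ)) ?_ (fun _ _ => .of_discrete) ?_ ?_
  · rintro _ ⟨i, rfl⟩ _ ⟨j, rfl⟩ ⟨x, hx, hx'⟩
    obtain rfl : x = i := hx
    obtain rfl : x = j := hx'
    exact ⟨x, (Set.inter_self _).symm⟩
  · intro u _ x hx
    exact ⟨{x}, ⟨x, rfl⟩, mem_nhds_discrete.2 rfl, Set.singleton_subset_iff.2 hx⟩
  · rintro _ ⟨j, rfl⟩
    exact h j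

end Poisson

/-! ### Giant component, connectedness and the sharp threshold. -/

section Limits

theorem faceLaw_real_isConnected_le (hk : 1 ≤ k) (hn : k < n) (p : unitInterval) :
    (faceLaw n k p).real {X | IsConnected (HG hk X)} ≤
      (faceLaw n k p).real {X | isolatedFaces k X = ∅} :=
  faceLaw_real_mono p fun _ h => isolatedFaces_eq_empty_of_isConnected hn h

theorem faceLaw_real_eq_empty_le (hk : 1 ≤ k) (hn : 2 * k < n) (p : unitInterval) :
    (faceLaw n k p).real {X | isolatedFaces k X = ∅} ≤
      (faceLaw n k p).real {X | IsConnected (HG hk X)} +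
        (faceLaw n k p).real {X | HasSmallCluster k X} := by
  refine (faceLaw_real_mono p fun X hX => ?_).trans (measureReal_union_le _ _)
  by_cases h : HasSmallCluster k X
  · exact Or.inr h
  · exact Or.inl (isConnected_of_isolatedFaces_eq_empty h hn hX)

theorem one_sub_binomialMoment_le (p : unitInterval) :
    1 - binomialMoment n k p 1 ≤ (faceLaw n k p).real {X | isolatedFaces k X = ∅} := by
  have h₁ := mul_faceLaw_real_le_card_le (n := n) (k := k) p 1
  have h₂ : {X : Set (Finset (Fin n)) | (1 : ℝ) ≤ (isolatedFaces k X).card} =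
      {X | isolatedFaces k X = ∅}ᶜ := by
    ext X
    simp [Nat.one_le_iff_ne_zero]
  rw [h₂, one_mul, probReal_compl_eq_one_sub .of_discrete] at h₁
  linarith

theorem tendsto_isGiantPlusIsolated {p : ℕ → unitInterval} {c : ℝ} (hk : 1 ≤ k)
    (hp : ∀ᶠ n : ℕ in atTop, (p n : ℝ) = (k * Real.log n + c) / n) {ε : ℝ} (hε : 0 < ε) :
    Tendsto (fun n : ℕ => (faceLaw n k (p n)).real
      {X | IsGiantPlusIsolated (HG hk X) ε}) atTop (𝓝 1) := by
  have hclus := tendsto_faceLaw_real_hasSmallCluster hk c p (hp.mono fun _ hn => hn.ge)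
  have hM := tendsto_choose_mul_one_sub_pow hp
  simp_rw [← binomialMoment_one] at hM
  have hmarkov : ∀ a : ℕ → ℝ, Tendsto a atTop atTop →
      Tendsto (fun n => (faceLaw n k (p n)).real {X | a n ≤ (isolatedFaces k X).card}) atTop
        (𝓝 0) := by
    intro a ha
    refine squeeze_zero' (.of_forall fun n => measureReal_nonneg) ?_ (hM.div_atTop ha)
    filter_upwards [ha.eventually_gt_atTop 0] with n hn
    rw [le_div_iff₀' hn]
    exact mul_faceLaw_real_le_card_le _ _
  have hk0 : (0 : ℝ) < k := by exact_mod_cast hk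
  -- The two Markov thresholds match the two needs: a fresh vertex outside all isolated faces, and
  -- at most an ε proportion of isolated faces.
  have h₁ := hmarkov (fun n => (n - 2 * k : ℝ) / k)
    ((tendsto_atTop_add_const_right _ _ tendsto_natCast_atTop_atTop).atTop_div_const hk0)
  have h₂ := hmarkov (fun n => ε * n.choose k)
    ((tendsto_natCast_atTop_atTop.comp (tendsto_choose_atTop hk)).const_mul_atTop hε)
  have h₃ := ((hclus.add h₁).add h₂).const_sub 1
  norm_num only at h₃
  refine tendsto_of_tendsto_of_tendsto_of_le_of_le h₃ tendsto_const_nhds (fun n => ?_)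
    fun n => measureReal_le_one
  simp only
  rw [sub_le_comm, ← probReal_compl_eq_one_sub .of_discrete]
  refine (faceLaw_real_mono (p n) (t := ({X | HasSmallCluster k X} ∪
    {X | (n - 2 * k : ℝ) / k ≤ (isolatedFaces k X).card}) ∪
    {X | ε * n.choose k ≤ (isolatedFaces k X).card}) fun X hX => ?_).trans
    ((measureReal_union_le _ _).trans (add_le_add_left (measureReal_union_le _ _) _))
  by_contra hcon
  simp only [Set.mem_union, Set.mem_ofPred_eq, not_or, not_le] at hcon
  obtain ⟨⟨hc, ha⟩, hb⟩ := hcon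
  refine hX (isGiantPlusIsolated_of_not_hasSmallCluster hc ?_ hb.le)
  rw [lt_div_iff₀ hk0] at ha
  have : (k : ℝ) * (isolatedFaces k X).card + 2 * k < n := by linarith
  exact_mod_cast this

/-- For large n, connectedness implies that no face is isolated, and the converse fails only when
there is a small cluster. -/
theorem tendsto_isConnected_of_tendsto {p : ℕ → unitInterval} {c x : ℝ} (hk : 1 ≤ k)
    (hp : ∀ᶠ n : ℕ in atTop, (k * Real.log n + c) / n ≤ (p n : ℝ))
    (h : Tendsto (fun n => (faceLaw n k (p n)).real {X | isolatedFaces k X = ∅}) atTop (𝓝 x)) :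
    Tendsto (fun n : ℕ => (faceLaw n k (p n)).real {X | IsConnected (HG hk X)}) atTop (𝓝 x) := by
  have hclus := tendsto_faceLaw_real_hasSmallCluster hk c p hp
  have h' := h.sub hclus
  rw [sub_zero] at h'
  refine tendsto_of_tendsto_of_tendsto_of_le_of_le' h' h ?_ ?_
  · filter_upwards [eventually_gt_atTop (2 * k)] with n hn
    have := faceLaw_real_eq_empty_le hk hn (p n)
    linarith
  · filter_upwards [eventually_gt_atTop k] with n hn
    exact faceLaw_real_isConnected_le hk hn (p n)

theorem tendsto_isConnected {p : ℕ → unitInterval} {c : ℝ} (hk : 1 ≤ k)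
    (hp : ∀ᶠ n : ℕ in atTop, (p n : ℝ) = (k * Real.log n + c) / n) :
    Tendsto (fun n : ℕ => (faceLaw n k (p n)).real {X | IsConnected (HG hk X)}) atTop
      (𝓝 (Real.exp (-(Real.exp (-c) / k.factorial)))) := by
  refine tendsto_isConnected_of_tendsto hk (hp.mono fun _ hn => hn.ge) ?_
  simpa using tendsto_faceLaw_real_card_isolatedFaces hk hp 0

theorem tendstoInDistribution_ncard_isolated {p : ℕ → unitInterval} {c : ℝ} (hk : 1 ≤ k)
    (hp : ∀ᶠ n : ℕ in atTop, (p n : ℝ) = (k * Real.log n + c) / n) :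
    TendstoInDistribution
      (fun (n : ℕ) (X : Set (Finset (Fin n))) => (isolated (HG hk X)).ncard)
      atTop (id : ℕ → ℕ) (fun n : ℕ => faceLaw n k (p n))
      (poissonMeasure (Real.toNNReal (Real.exp (-c) / (Nat.factorial k : ℝ)))) where
  forall_aemeasurable n := Measurable.of_discrete.aemeasurable
  aemeasurable_limit := measurable_id.aemeasurable
  tendsto := by
    refine tendsto_probabilityMeasure_nat fun j => ?_
    rw [← NNReal.tendsto_coe]
    have h := tendsto_faceLaw_real_card_isolatedFaces hk hp j
    have e₁ : ∀ n, (faceLaw n k (p n)).real {X | (isolatedFaces k X).card = j} =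
        ((faceLaw n k (p n)).map (fun X => (isolated (HG hk X)).ncard)).real {j} := by
      intro n
      rw [map_measureReal_apply .of_discrete .of_discrete]
      congr 1
      ext X
      simp [isolated_HG]
    have e₂ : Real.exp (-(Real.exp (-c) / k.factorial)) * (Real.exp (-c) / k.factorial) ^ j /
        j.factorial =
        ((poissonMeasure (Real.toNNReal (Real.exp (-c) / (Nat.factorial k : ℝ)))).map id).real
          {j} := by
      rw [Measure.map_id, poissonMeasure_real_singleton, Real.coe_toNNReal _ (by positivity)]
    simp_rw [e₁] at h
    rw [e₂] at h
    exact h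

theorem tendsto_isConnected_one {p : ℕ → unitInterval} {ω : ℕ → ℝ} (hk : 1 ≤ k)
    (hω : Tendsto ω atTop atTop)
    (hp : ∀ᶠ n : ℕ in atTop, (k * Real.log n + ω n) / n ≤ (p n : ℝ)) :
    Tendsto (fun n : ℕ => (faceLaw n k (p n)).real {X | IsConnected (HG hk X)}) atTop (𝓝 1) := by
  refine tendsto_isConnected_of_tendsto (c := 0) hk ?_ ?_
  · filter_upwards [hp, hω.eventually_ge_atTop 0] with n hn h0
    refine le_trans ?_ hn
    gcongr
  -- The extra k pays for the exponent n - k in place of n, using kp ≤ k; here p need not tend to 0.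
  have hexp : Tendsto (fun n => 1 - Real.exp (k - ω n)) atTop (𝓝 1) := by
    have h₁ : Tendsto (fun n => (k : ℝ) - ω n) atTop atBot :=
      tendsto_atBot_add_const_left _ _ (tendsto_neg_atTop_atBot.comp hω)
    simpa using (Real.tendsto_exp_atBot.comp h₁).const_sub 1
  refine tendsto_of_tendsto_of_tendsto_of_le_of_le' hexp tendsto_const_nhds ?_
    (.of_forall fun n => measureReal_le_one)
  filter_upwards [hp, eventually_ge_atTop (k + 1)] with n hn hnk
  refine le_trans ?_ (one_sub_binomialMoment_le (p n))
  have hn0 : (0 : ℝ) < n := by exact_mod_cast (by omega : 0 < n)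
  rw [div_le_iff₀ hn0] at hn
  rw [binomialMoment_one]
  gcongr
  have h₁ : (n.choose k : ℝ) ≤ (n : ℝ) ^ k := by exact_mod_cast Nat.choose_le_pow n k
  have hq : (0 : ℝ) ≤ 1 - p n := by linarith [(p n).2.2]
  calc (n.choose k : ℝ) * (1 - p n : ℝ) ^ (n - k)
      ≤ (n : ℝ) ^ k * Real.exp (-(p n : ℝ)) ^ (n - k) := by
        gcongr
        exact Real.one_sub_le_exp_neg _
    _ = Real.exp (k * Real.log n + (n - k) * -(p n : ℝ)) := by
        rw [Real.exp_add, Real.exp_nat_mul, Real.exp_log hn0, ← Real.exp_nat_mul,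
          Nat.cast_sub (by omega)]
    _ ≤ Real.exp (k - ω n) := by
        gcongr
        have : (k : ℝ) * p n ≤ k * 1 := by
          have := (p n).2.2
          gcongr
        linarith

theorem tendsto_isConnected_zero {p : ℕ → unitInterval} {ω : ℕ → ℝ} (hk : 1 ≤ k)
    (hω : Tendsto ω atTop atTop)
    (hp : ∀ᶠ n : ℕ in atTop, (p n : ℝ) ≤ (k * Real.log n - ω n) / n) :
    Tendsto (fun n : ℕ => (faceLaw n k (p n)).real {X | IsConnected (HG hk X)}) atTop (𝓝 0) := by
  obtain ⟨h₁, h₂⟩ : Tendsto (fun n => (p n : ℝ)) atTop (𝓝 0) ∧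
      Tendsto (fun n : ℕ => n * (p n : ℝ) ^ 2) atTop (𝓝 0) := by
    refine tendsto_of_le_log (a := k) (c := 0) ?_
    filter_upwards [hp, hω.eventually_ge_atTop 0] with n hn h0
    refine hn.trans ?_
    gcongr
    linarith
  have hpow : Tendsto (fun n : ℕ => (n : ℝ) ^ k * (1 - p n : ℝ) ^ n) atTop atTop := by
    have h₃ : Tendsto (fun n : ℕ => Real.exp (ω n - 2 * (n * (p n : ℝ) ^ 2))) atTop atTop := by
      refine Real.tendsto_exp_atTop.comp ?_
      simp_rw [sub_eq_add_neg]
      exact hω.atTop_add (h₂.const_mul 2).neg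
    refine tendsto_atTop_mono' _ ?_ h₃
    filter_upwards [hp, eventually_ge_atTop 1,
      h₁.eventually_le_const (show (0 : ℝ) < 1 / 2 by norm_num)] with n hn hn1 hn2
    refine le_trans ?_ (le_pow_mul_one_sub_pow hn2 hn1)
    have hn0 : (0 : ℝ) < n := by exact_mod_cast hn1
    rw [le_div_iff₀ hn0] at hn
    gcongr
    linarith
  have hM : Tendsto (fun n => binomialMoment n k (p n) 1) atTop atTop := by
    have h₃ := (tendsto_choose_div_pow k).pos_mul_atTop (by positivity) hpow
    refine tendsto_atTop_mono' _ ?_ h₃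
    filter_upwards [eventually_ge_atTop 1] with n hn1
    have hn0 : (n : ℝ) ≠ 0 := by positivity
    rw [binomialMoment_one, div_mul_eq_mul_div, mul_left_comm, mul_div_cancel_left₀ _ (by positivity)]
    refine mul_le_mul_of_nonneg_left ?_ (by positivity)
    exact pow_le_pow_of_le_one (by linarith [(p n).2.2]) (by linarith [(p n).2.1])
      (Nat.sub_le _ _)
  -- The Chebyshev bound after division by M²: the exponent 2² is the overlap r² for r = 2, and 1/M
  -- comes from the diagonal term of the second moment.
  have hlim : Tendsto (fun n => ((1 - p n : ℝ) ^ (2 ^ 2))⁻¹ +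
      (binomialMoment n k (p n) 1)⁻¹ - 1) atTop (𝓝 0) := by
    have := ((((h₁.const_sub 1).pow (2 ^ 2)).inv₀ (by simp)).add hM.inv_tendsto_atTop).sub_const 1
    simpa using this
  refine squeeze_zero' (.of_forall fun n => measureReal_nonneg) ?_ hlim
  filter_upwards [eventually_gt_atTop k, hM.eventually_gt_atTop 0,
    h₁.eventually_lt_const zero_lt_one] with n hn hM0 hp1
  refine (faceLaw_real_isConnected_le hk hn (p n)).trans ?_
  have h₄ := faceLaw_real_eq_empty_mul_le (n := n) (k := k) (p n)
  have h₅ := binomialMoment_mul_pow_le (n := n) (k := k) (p n) 2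
  have hq : (0 : ℝ) < (1 - p n : ℝ) ^ (2 ^ 2) := pow_pos (by linarith) _
  have h₆ : ((n.choose k).choose 2 : ℝ) * ((1 - p n : ℝ) ^ (n - k)) ^ 2 ≤
      binomialMoment n k (p n) 1 ^ 2 / 2 := by
    rw [binomialMoment_one, mul_pow, ← div_mul_eq_mul_div]
    gcongr
    rw [Nat.cast_choose_two]
    gcongr
    have : (0 : ℝ) ≤ n.choose k := by positivity
    nlinarith
  have h₇ : 2 * binomialMoment n k (p n) 2 ≤
      binomialMoment n k (p n) 1 ^ 2 * ((1 - p n : ℝ) ^ (2 ^ 2))⁻¹ := by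
    rw [← div_eq_mul_inv, le_div_iff₀ hq]
    linarith
  generalize binomialMoment n k (p n) 1 = M at *
  have hMsq : 0 < M ^ 2 := by positivity
  refine le_of_mul_le_mul_right (h₄.trans ?_) hMsq
  have : (((1 - p n : ℝ) ^ (2 ^ 2))⁻¹ + M⁻¹ - 1) * M ^ 2 =
      M ^ 2 * ((1 - p n : ℝ) ^ (2 ^ 2))⁻¹ + M - M ^ 2 := by
    field_simp
  rw [this]
  linarith

end Limits

end RandomComplex

theorem theorem1p8 (k : ℕ) (hk : 1 ≤ k) :
    (∀ (c : ℝ) (p : ℕ → unitInterval),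
      (∀ᶠ n : ℕ in atTop, (p n : ℝ) = ((k : ℝ) * Real.log n + c) / n) →
        (∀ ε : ℝ, 0 < ε →
          Tendsto (fun n : ℕ => (RandomComplex.faceLaw n k (p n)).real
            {X | RandomComplex.IsGiantPlusIsolated (RandomComplex.HG hk X) ε}) atTop (𝓝 1)) ∧
        TendstoInDistribution
          (fun (n : ℕ) (X : Set (Finset (Fin n))) =>
            (RandomComplex.isolated (RandomComplex.HG hk X)).ncard)
          atTop (id : ℕ → ℕ)
          (fun n : ℕ => RandomComplex.faceLaw n k (p n))
          (poissonMeasure (Real.toNNReal (Real.exp (-c) / (Nat.factorial k : ℝ)))) ∧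
        Tendsto (fun n : ℕ => (RandomComplex.faceLaw n k (p n)).real
            {X | RandomComplex.IsConnected (RandomComplex.HG hk X)}) atTop
          (𝓝 (Real.exp (-(Real.exp (-c) / (Nat.factorial k : ℝ)))))) ∧
    (∀ (ω : ℕ → ℝ) (p : ℕ → unitInterval), Tendsto ω atTop atTop →
      ((∀ᶠ n : ℕ in atTop, ((k : ℝ) * Real.log n + ω n) / n ≤ (p n : ℝ)) →
        Tendsto (fun n : ℕ => (RandomComplex.faceLaw n k (p n)).real
          {X | RandomComplex.IsConnected (RandomComplex.HG hk X)}) atTop (𝓝 1)) ∧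
      ((∀ᶠ n : ℕ in atTop, (p n : ℝ) ≤ ((k : ℝ) * Real.log n - ω n) / n) →
        Tendsto (fun n : ℕ => (RandomComplex.faceLaw n k (p n)).real
          {X | RandomComplex.IsConnected (RandomComplex.HG hk X)}) atTop (𝓝 0))) :=
  ⟨fun _ _ hp => ⟨fun _ hε => RandomComplex.tendsto_isGiantPlusIsolated hk hp hε,
      RandomComplex.tendstoInDistribution_ncard_isolated hk hp,
      RandomComplex.tendsto_isConnected hk hp⟩,
    fun _ _ hω => ⟨RandomComplex.tendsto_isConnected_one hk hω,
      RandomComplex.tendsto_isConnected_zero hk hω⟩⟩
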